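/- Let $b\ge 2$ be an integer, let $\pi_0,\dots,\pi_{b-1}\in[0,1]$ satisfy $\sum_{i=0}^{b-1}\pi_i=1$, and let $\delta\ge 1$ be real. For $y\in[0,1]$ with $b$-adic expansion $y=\sum_{m\ge1}y_m b^{-m}$, $y_m\in\{0,\dots,b-1\}$ (for points with two expansions one of them is chosen, in an arbitrary way), put $\phi_{i,n}(y)=\frac1n\,\#\{1\le m\le n:\ y_m=i\}$. Let $E_\delta^{\pi_0,\dots,\pi_{b-1}}$ be the set of all $x\in[0,1]$ for which there is a sequence $(p_n,q_n)_n$ of pairs of positive integers with $p_n\le q_n$ such that $$q_n\to+\infty,\qquad \Big|x-\frac{p_n}{q_n}\Big|\le \frac1{q_n^{2\delta}}\ \text{ for all } n,\qquad \lim_{n\to\infty}\phi_{i,[\log_b(q_n^2)]}\Big(\frac{p_n}{q_n}\Big)=\pi_i\ \text{ for all } i\in\{0,\dots,b-1\},$$ where $[\cdot]$ is the integer part. Then, whatever choice of expansions was made, the Hausdorff dimension of this set is $$\dim E_\delta^{\pi_0,\dots,\pi_{b-1}}=\frac{\sum_{i=0}^{b-1}-\pi_i\log_b\pi_i}{\delta},$$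 with the convention $0\log_b 0=0$. -/

import Mathlib

open Filter Topology

noncomputable section

/-- `d` chooses, for every `y ∈ [0,1]`, a `b`-adic expansion `y = ∑_{m ≥ 0} d y m * b ^ (-(m+1))`.
(Points `k / b ^ j` of `(0,1)` have two expansions, all other points of `[0,1]` have one.) -/
def IsExpansionChoice (b : ℕ) (d : ℝ → ℕ → Fin b) : Prop :=
  ∀ y ∈ Set.Icc (0 : ℝ) 1, Real.ofDigits (d y) = y

/-- The frequency of the digit `i` among the first `n` terms of the digit sequence `a`. -/
def digitFreq {b : ℕ} (a : ℕ → Fin b) (i : Fin b) (n : ℕ) : ℝ :=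
  ((Finset.range n).filter (fun m => a m = i)).card / (n : ℝ)

/-- The points `x ∈ [0,1]` that are approximated at rate `q ^ (-2δ)` by fractions `p / q ∈ (0,1]`
whose digit frequencies, read off the first `⌊log_b (q ^ 2)⌋` digits, tend to `π`. -/
def approxSet (b : ℕ) (d : ℝ → ℕ → Fin b) (π : Fin b → ℝ) (δ : ℝ) : Set ℝ :=
  {x | x ∈ Set.Icc (0 : ℝ) 1 ∧ ∃ p q : ℕ → ℕ,
    (∀ n, 0 < p n ∧ 0 < q n ∧ p n ≤ q n) ∧
    Tendsto q atTop atTop ∧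
    (∀ n, |x - (p n : ℝ) / (q n : ℝ)| ≤ 1 / (q n : ℝ) ^ (2 * δ)) ∧
    ∀ i, Tendsto
      (fun n => digitFreq (d ((p n : ℝ) / (q n : ℝ))) i ⌊Real.logb b ((q n : ℝ) ^ 2)⌋₊)
      atTop (𝓝 (π i))}

end

/-! Write H for the entropy `∑ i, Real.negMulLog (π i)`; the claimed dimension is H / (δ log b). The
basic count is that about exp(nH) words of length n have digit frequencies close to π
(`exists_card_typicalWords_le`, `eventually_le_card_typicalWords`).

Upper bound. Distinct fractions with squared denominators below b^(n+1) are more than b^(-(n+1))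
apart, so a fraction with q² in [b^n, b^(n+1)) is determined by the half-open b-adic interval of
rank n + 1 containing it. Only about exp(nH) such intervals, up to a factor b + 1, continue a
typical word of length n. Balls of radius b^(-nδ) around these fractions, over all n ≥ N, cover the
set, and the sum of the s-th powers of their diameters tends to 0 as N grows, once s δ log b > H
(`hausdorffMeasure_approxSet_eq_zero`).

Lower bound. A Cantor set is built in stages: a long run of freely chosen typical blocks of L
digits, then a jump to an interval so short that all its points are q^(-2δ)-close to a fraction p/q
whose digits are those of the run. The difficulty is to find p/q in a prescribed interval of rank
about n with q² comparable to b^n: Dirichlet's theorem bounds q from above only. Therefore blocks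
that come near fractions of small denominator are forbidden. This costs at most 6 blocks per step
(`card_le_card_legalLetters_add`), which is negligible against the exponential number of typical
ones, and it forces Dirichlet's denominator to lie between b^(j-2L) and b^j
(`IsLegalPath.exists_fraction`). The jump multiplies the rank by about δ without increasing the
number of nodes, hence the factor 1 / δ. The uniform measure on the branches and the mass
distribution principle (`ofReal_le_dimH_treeSet`) give the dimension. -/

/-! ### Base b prefixes and digit counts. -/

/-- The integer whose base `b` digits are the first `n` terms of `a`. -/
def prefixValue {b : ℕ} (a : ℕ → Fin b) : ℕ → ℕ
  | 0 => 0
  | n + 1 => prefixValue a n * b + a n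

/-- The number of occurrences of the digit `i` among the first `n` terms of `a`. -/
def digitCount {b : ℕ} (a : ℕ → Fin b) (i : Fin b) (n : ℕ) : ℕ :=
  ((Finset.range n).filter (fun m => a m = i)).card

theorem digitFreq_eq {b : ℕ} (a : ℕ → Fin b) (i : Fin b) (n : ℕ) :
    digitFreq a i n = digitCount a i n / (n : ℝ) := rfl

theorem prefixValue_lt {b : ℕ} (a : ℕ → Fin b) (n : ℕ) : prefixValue a n < b ^ n := by
  induction n with
  | zero => simp [prefixValue]
  | succ n ih =>
    have h1 := (a n).isLt
    have h2 : (prefixValue a n + 1) * b ≤ b ^ n * b := Nat.mul_le_mul_right b ih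
    rw [prefixValue, pow_succ]
    linarith

theorem prefixValue_add {b : ℕ} (a : ℕ → Fin b) (n l : ℕ) :
    prefixValue a (n + l) = prefixValue a n * b ^ l + prefixValue (fun m => a (n + m)) l := by
  induction l with
  | zero => simp [prefixValue]
  | succ l ih =>
    rw [← add_assoc, prefixValue, ih, prefixValue]
    ring

theorem prefixValue_add_div {b : ℕ} (a : ℕ → Fin b) (n l : ℕ) :
    prefixValue a (n + l) / b ^ l = prefixValue a n := by
  have hb : 0 < b := (a 0).pos
  rw [prefixValue_add, mul_comm, Nat.mul_add_div (by positivity),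
    Nat.div_eq_of_lt (prefixValue_lt _ _), add_zero]

theorem prefixValue_congr {b : ℕ} {a a' : ℕ → Fin b} {n : ℕ} (h : ∀ m < n, a m = a' m) :
    prefixValue a n = prefixValue a' n := by
  induction n with
  | zero => rfl
  | succ n ih => rw [prefixValue, prefixValue, ih fun m hm => h m (by omega), h n (by omega)]

theorem digits_eq_of_prefixValue_eq {b : ℕ} {a a' : ℕ → Fin b} {n : ℕ}
    (h : prefixValue a n = prefixValue a' n) : ∀ m < n, a m = a' m := by
  induction n with
  | zero => simp
  | succ n ih =>
    have hb : 0 < b := (a 0).pos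
    have h1 : prefixValue a n = prefixValue a' n := by
      have := prefixValue_add_div a n 1
      rw [h, prefixValue_add_div] at this
      exact this.symm
    intro m hm
    rcases Nat.lt_succ_iff_lt_or_eq.mp hm with h2 | rfl
    · exact ih h1 m h2
    · rw [prefixValue, prefixValue, h1] at h
      exact Fin.ext (by omega)

theorem digitCount_succ {b : ℕ} (a : ℕ → Fin b) (i : Fin b) (n : ℕ) :
    digitCount a i (n + 1) = digitCount a i n + if a n = i then 1 else 0 := by
  unfold digitCount
  rw [Finset.range_add_one, Finset.filter_insert]
  split_ifs with h <;> simp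

theorem digitCount_add {b : ℕ} (a : ℕ → Fin b) (i : Fin b) (n l : ℕ) :
    digitCount a i (n + l) = digitCount a i n + digitCount (fun m => a (n + m)) i l := by
  induction l with
  | zero => simp [digitCount]
  | succ l ih => rw [← add_assoc, digitCount_succ, ih, digitCount_succ, add_assoc]

theorem digitCount_le {b : ℕ} (a : ℕ → Fin b) (i : Fin b) (n : ℕ) : digitCount a i n ≤ n := by
  simpa [digitCount] using Finset.card_filter_le (Finset.range n) (fun m => a m = i)

theorem sum_ofDigitsTerm {b : ℕ} (a : ℕ → Fin b) (n : ℕ) :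
    ∑ i ∈ Finset.range n, Real.ofDigitsTerm a i = prefixValue a n / (b : ℝ) ^ n := by
  have hb : (b : ℝ) ≠ 0 := Nat.cast_ne_zero.mpr (a 0).pos.ne'
  induction n with
  | zero => simp [prefixValue]
  | succ n ih =>
    rw [Finset.sum_range_succ, ih, prefixValue, Real.ofDigitsTerm]
    push_cast
    field_simp
    ring

theorem prefixValue_div_le {b : ℕ} (a : ℕ → Fin b) (n : ℕ) :
    prefixValue a n / (b : ℝ) ^ n ≤ Real.ofDigits a := by
  rw [Real.ofDigits_eq_sum_add_ofDigits a n, sum_ofDigitsTerm]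
  have := Real.ofDigits_nonneg (fun i => a (i + n))
  have : 0 ≤ ((b : ℝ) ^ n)⁻¹ * Real.ofDigits (fun i => a (i + n)) := by positivity
  linarith

theorem le_prefixValue_add_one_div {b : ℕ} (a : ℕ → Fin b) (n : ℕ) :
    Real.ofDigits a ≤ (prefixValue a n + 1) / (b : ℝ) ^ n := by
  rw [Real.ofDigits_eq_sum_add_ofDigits a n, sum_ofDigitsTerm, add_div, one_div]
  have h1 := Real.ofDigits_le_one (fun i => a (i + n))
  have h2 : 0 ≤ ((b : ℝ) ^ n)⁻¹ := by positivity
  have := mul_le_of_le_one_right h2 h1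
  linarith

/-- A point in the open `b`-adic interval of rank `n` and index `k` has only expansions whose first
`n` digits are those of `k`. -/
theorem prefixValue_eq_of_mem_Ioo {b : ℕ} {a : ℕ → Fin b} {n k : ℕ}
    (h1 : k / (b : ℝ) ^ n < Real.ofDigits a) (h2 : Real.ofDigits a < (k + 1) / (b : ℝ) ^ n) :
    prefixValue a n = k := by
  have hb : 0 < (b : ℝ) ^ n := pow_pos (Nat.cast_pos.mpr (a 0).pos) n
  have h3 := h1.trans_le (le_prefixValue_add_one_div a n)
  have h4 := (prefixValue_div_le a n).trans_lt h2
  rw [div_lt_div_iff_of_pos_right hb] at h3 h4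
  norm_cast at h3 h4
  omega

/-! ### Counting words with prescribed digit frequencies -/

/-- The number of occurrences of the letter `i` in the word `w`. -/
def letterCount {b n : ℕ} (w : Fin n → Fin b) (i : Fin b) : ℕ :=
  (Finset.univ.filter (fun m => w m = i)).card

theorem sum_apply_eq_sum_letterCount {b n : ℕ} (w : Fin n → Fin b) (f : Fin b → ℝ) :
    ∑ m, f (w m) = ∑ i, letterCount w i * f i := by
  have h : ∀ i, (letterCount w i : ℝ) * f i = ∑ m, if w m = i then f i else 0 := by
    intro i
    rw [← Finset.sum_filter, Finset.sum_const, nsmul_eq_mul, letterCount]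
  simp_rw [h]
  rw [Finset.sum_comm]
  simp

/-- The words of length `n` in which every letter `i` has frequency `π i` up to `ε`. -/
noncomputable def typicalWords {b : ℕ} (π : Fin b → ℝ) (ε : ℝ) (n : ℕ) : Finset (Fin n → Fin b) :=
  open Classical in
  Finset.univ.filter (fun w => ∀ i, |(letterCount w i : ℝ) - n * π i| ≤ ε * n)

theorem mem_typicalWords {b : ℕ} {π : Fin b → ℝ} {ε : ℝ} {n : ℕ} {w : Fin n → Fin b} :
    w ∈ typicalWords π ε n ↔ ∀ i, |(letterCount w i : ℝ) - n * π i| ≤ ε * n := by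
  simp [typicalWords]

theorem abs_sum_apply_sub_le {b : ℕ} {π : Fin b → ℝ} {ε : ℝ} {n : ℕ} {w : Fin n → Fin b}
    (hw : w ∈ typicalWords π ε n) (f : Fin b → ℝ) :
    |∑ m, f (w m) - n * ∑ i, π i * f i| ≤ n * (ε * ∑ i, |f i|) := by
  rw [sum_apply_eq_sum_letterCount, Finset.mul_sum, ← Finset.sum_sub_distrib, Finset.mul_sum,
    Finset.mul_sum]
  refine (Finset.abs_sum_le_sum_abs _ _).trans (Finset.sum_le_sum fun i _ => ?_)
  rw [show (letterCount w i : ℝ) * f i - n * (π i * f i) = (letterCount w i - n * π i) * f i by ring,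
    abs_mul, show (n : ℝ) * (ε * |f i|) = ε * n * |f i| by ring]
  exact mul_le_mul_of_nonneg_right (mem_typicalWords.mp hw i) (abs_nonneg _)

/-- Mixing π with the uniform distribution makes every weight positive, so that words containing
letters of π-weight zero can be counted as well. As log is increasing, the cross entropy exceeds the
entropy by at most -log(1 - η). -/
theorem sum_neg_mul_log_mix_le {b : ℕ} {π : Fin b → ℝ} (hπ : ∀ i, 0 ≤ π i)
    (hπ1 : ∑ i, π i = 1) {η : ℝ} (hη : 0 < η) (hη1 : η < 1) :
    ∑ i, π i * -Real.log ((1 - η) * π i + η / b) ≤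
      ∑ i, Real.negMulLog (π i) - Real.log (1 - η) := by
  have : ∑ i, Real.negMulLog (π i) - Real.log (1 - η) =
      ∑ i, (Real.negMulLog (π i) - π i * Real.log (1 - η)) := by
    rw [Finset.sum_sub_distrib, ← Finset.sum_mul, hπ1, one_mul]
  rw [this]
  refine Finset.sum_le_sum fun i _ => ?_
  rcases (hπ i).eq_or_lt with h | h
  · simp [← h]
  · have h1 : Real.log ((1 - η) * π i) ≤ Real.log ((1 - η) * π i + η / b) :=
      Real.log_le_log (mul_pos (by linarith) h) (le_add_of_nonneg_right (by positivity))
    rw [Real.log_mul (by linarith) h.ne'] at h1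
    rw [Real.negMulLog]
    nlinarith

/-- Upper bound for the number of words with digit frequencies close to `π`. -/
theorem exists_card_typicalWords_le {b : ℕ} {π : Fin b → ℝ} (hπ : ∀ i, 0 ≤ π i)
    (hπ1 : ∑ i, π i = 1) {h : ℝ} (hh : ∑ i, Real.negMulLog (π i) < h) :
    ∃ ε > 0, ∀ n : ℕ, ((typicalWords π ε n).card : ℝ) ≤ Real.exp (n * h) := by
  have hb : 0 < b := by
    rcases Nat.eq_zero_or_pos b with rfl | hb
    · simp at hπ1
    · exact hb
  have hb' : (0 : ℝ) < b := Nat.cast_pos.mpr hb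
  obtain ⟨η, hη, hη1, hηh⟩ : ∃ η : ℝ, 0 < η ∧ η < 1 ∧
      ∑ i, Real.negMulLog (π i) - Real.log (1 - η) < h := by
    have hc : Tendsto (fun η : ℝ => ∑ i, Real.negMulLog (π i) - Real.log (1 - η)) (𝓝[>] 0)
        (𝓝 (∑ i, Real.negMulLog (π i) - Real.log (1 - 0))) := by
      refine tendsto_nhdsWithin_of_tendsto_nhds (ContinuousAt.tendsto ?_)
      have : (1 : ℝ) - 0 ≠ 0 := by norm_num
      fun_prop (disch := assumption)
    rw [sub_zero, Real.log_one, sub_zero] at hc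
    have h1 := hc.eventually (gt_mem_nhds hh)
    have h2 : ∀ᶠ η : ℝ in 𝓝[>] 0, η ∈ Set.Ioo (0 : ℝ) 1 := Ioo_mem_nhdsGT one_pos
    obtain ⟨η, h3, h4⟩ := (h1.and h2).exists
    exact ⟨η, h4.1, h4.2, h3⟩
  set ρ : Fin b → ℝ := fun i => (1 - η) * π i + η / b with hρ
  have hρ0 : ∀ i, 0 < ρ i := fun i =>
    add_pos_of_nonneg_of_pos (mul_nonneg (by linarith) (hπ i)) (by positivity)
  have hρ1 : ∑ i, ρ i = 1 := by
    simp only [hρ, Finset.sum_add_distrib, ← Finset.mul_sum, hπ1, Finset.sum_const,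
      Finset.card_univ, Fintype.card_fin, nsmul_eq_mul]
    field_simp
    ring
  have hent := (sum_neg_mul_log_mix_le hπ hπ1 hη hη1).trans_lt hηh
  set K : ℝ := ∑ i, |Real.log (ρ i)| with hK
  have hK0 : 0 ≤ K := Finset.sum_nonneg fun i _ => abs_nonneg _
  set g : ℝ := ∑ i, π i * -Real.log (ρ i) with hg
  -- The denominator is K + 1 because K may vanish.
  refine ⟨(h - g) / (K + 1), div_pos (by linarith) (by linarith), fun n => ?_⟩
  set ε : ℝ := (h - g) / (K + 1) with hε
  have hεK : ε * K ≤ h - g := by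
    rw [hε, div_mul_eq_mul_div, div_le_iff₀ (by linarith)]
    nlinarith
  -- Under the product measure with weights ρ each typical word has mass at least exp(-nh), and the
  -- total mass is 1.
  have hw : ∀ w ∈ typicalWords π ε n, Real.exp (-(n * h)) ≤ ∏ m, ρ (w m) := by
    intro w hw
    rw [← Real.exp_log (Finset.prod_pos fun m _ => hρ0 (w m)),
      Real.log_prod (fun m _ => (hρ0 (w m)).ne')]
    refine Real.exp_le_exp.mpr ?_
    have h1 := (abs_le.mp (abs_sum_apply_sub_le hw (fun i => Real.log (ρ i)))).1
    have h2 : ∑ i, π i * Real.log (ρ i) = -g := by simp [hg]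
    rw [h2, ← hK] at h1
    have h3 : (n : ℝ) * (ε * K) ≤ n * (h - g) := mul_le_mul_of_nonneg_left hεK (Nat.cast_nonneg n)
    linarith
  have h1 : ((typicalWords π ε n).card : ℝ) * Real.exp (-(n * h)) ≤ 1 := by
    calc ((typicalWords π ε n).card : ℝ) * Real.exp (-(n * h))
        = ∑ w ∈ typicalWords π ε n, Real.exp (-(n * h)) := by rw [Finset.sum_const, nsmul_eq_mul]
      _ ≤ ∑ w ∈ typicalWords π ε n, ∏ m, ρ (w m) := Finset.sum_le_sum hw
      _ ≤ ∑ w : Fin n → Fin b, ∏ m, ρ (w m) :=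
          Finset.sum_le_sum_of_subset_of_nonneg (Finset.subset_univ _)
            fun w _ _ => Finset.prod_nonneg fun m _ => (hρ0 _).le
      _ = 1 := by rw [← Fintype.sum_pow, hρ1, one_pow]
  rwa [Real.exp_neg, ← div_eq_mul_inv, div_le_one (Real.exp_pos _)] at h1

/-- First and second moment of a sum of independent centred variables on a finite alphabet. -/
theorem moments_of_centred {α : Type*} [Fintype α] {p g : α → ℝ} (hp1 : ∑ x, p x = 1)
    (hg : ∑ x, p x * g x = 0) (n : ℕ) :
    ∑ w : Fin n → α, (∏ m, p (w m)) * ∑ m, g (w m) = 0 ∧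
    ∑ w : Fin n → α, (∏ m, p (w m)) * (∑ m, g (w m)) ^ 2 = n * ∑ x, p x * g x ^ 2 := by
  induction n with
  | zero => simp
  | succ n ih =>
    have h0 : ∑ w : Fin n → α, ∏ m, p (w m) = 1 := by rw [← Fintype.sum_pow, hp1, one_pow]
    rw [← (Fin.consEquiv (fun _ => α)).sum_comp, ← (Fin.consEquiv (fun _ => α)).sum_comp,
      Fintype.sum_prod_type, Fintype.sum_prod_type]
    simp only [Fin.consEquiv, Equiv.coe_fn_mk, Fin.prod_univ_succ, Fin.sum_univ_succ,
      Fin.cons_zero, Fin.cons_succ]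
    constructor
    · have : ∀ x : α, ∑ w : Fin n → α, p x * (∏ m, p (w m)) * (g x + ∑ m, g (w m)) = p x * g x := by
        intro x
        have : ∀ w : Fin n → α, p x * (∏ m, p (w m)) * (g x + ∑ m, g (w m)) =
            p x * g x * (∏ m, p (w m)) + p x * ((∏ m, p (w m)) * ∑ m, g (w m)) :=
          fun w => by ring
        simp_rw [this]
        rw [Finset.sum_add_distrib, ← Finset.mul_sum, ← Finset.mul_sum, h0, ih.1]
        ring
      simp_rw [this]
      exact hg
    · have : ∀ x : α, ∑ w : Fin n → α, p x * (∏ m, p (w m)) * (g x + ∑ m, g (w m)) ^ 2 =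
          p x * g x ^ 2 + p x * (n * ∑ x, p x * g x ^ 2) := by
        intro x
        have : ∀ w : Fin n → α, p x * (∏ m, p (w m)) * (g x + ∑ m, g (w m)) ^ 2 =
            p x * g x ^ 2 * (∏ m, p (w m)) + 2 * p x * g x * ((∏ m, p (w m)) * ∑ m, g (w m)) +
              p x * ((∏ m, p (w m)) * (∑ m, g (w m)) ^ 2) :=
          fun w => by ring
        simp_rw [this]
        rw [Finset.sum_add_distrib, Finset.sum_add_distrib, ← Finset.mul_sum, ← Finset.mul_sum,
          ← Finset.mul_sum, h0, ih.1, ih.2]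
        ring
      simp_rw [this]
      rw [Finset.sum_add_distrib, ← Finset.sum_mul, hp1]
      push_cast
      ring

/-- The weak law of large numbers for digit frequencies. -/
theorem sum_prod_compl_typicalWords_le {b : ℕ} {π : Fin b → ℝ} (hπ : ∀ i, 0 ≤ π i)
    (hπ1 : ∑ i, π i = 1) {ε : ℝ} (hε : 0 < ε) {n : ℕ} (hn : 0 < n) :
    1 - b / (ε ^ 2 * n) ≤ ∑ w ∈ typicalWords π ε n, ∏ m, π (w m) := by
  classical
  have hn' : (0 : ℝ) < n := Nat.cast_pos.mpr hn
  have hle1 : ∀ i, π i ≤ 1 := fun i =>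
    hπ1 ▸ Finset.single_le_sum (fun j _ => hπ j) (Finset.mem_univ i)
  have hmom : ∀ i, ∑ w : Fin n → Fin b, (∏ m, π (w m)) * (letterCount w i - n * π i) ^ 2 ≤ n := by
    intro i
    set g : Fin b → ℝ := fun x => (if x = i then 1 else 0) - π i with hg
    have hg0 : ∑ x, π x * g x = 0 := by
      simp only [hg, mul_sub, Finset.sum_sub_distrib, ← Finset.sum_mul, hπ1]
      simp
    have h1 : ∀ w : Fin n → Fin b, (letterCount w i : ℝ) - n * π i = ∑ m, g (w m) := by
      intro w
      simp only [hg, Finset.sum_sub_distrib, Finset.sum_const, Finset.card_univ, Fintype.card_fin,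
        nsmul_eq_mul, letterCount, Finset.sum_boole]
    simp_rw [h1]
    rw [(moments_of_centred hπ1 hg0 n).2]
    refine mul_le_of_le_one_right hn'.le ?_
    rw [← hπ1]
    refine Finset.sum_le_sum fun x _ => mul_le_of_le_one_right (hπ x) ?_
    rw [sq_le_one_iff_abs_le_one, abs_le]
    have := hπ i
    have := hle1 i
    simp only [hg]
    split_ifs <;> constructor <;> linarith
  have hc : ∀ w ∉ typicalWords π ε n, (1 : ℝ) ≤
      ∑ i, ((letterCount w i : ℝ) - n * π i) ^ 2 / (ε * n) ^ 2 := by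
    intro w hw
    rw [mem_typicalWords] at hw
    push Not at hw
    obtain ⟨i, hi⟩ := hw
    have h1 : (1 : ℝ) ≤ ((letterCount w i : ℝ) - n * π i) ^ 2 / (ε * n) ^ 2 := by
      rw [one_le_div (by positivity), ← sq_abs ((letterCount w i : ℝ) - n * π i)]
      exact pow_le_pow_left₀ (by positivity) hi.le 2
    refine h1.trans (Finset.single_le_sum
      (f := fun i => ((letterCount w i : ℝ) - n * π i) ^ 2 / (ε * n) ^ 2)
      (fun j _ => by positivity) (Finset.mem_univ i))
  have hw0 : ∀ w : Fin n → Fin b, 0 ≤ ∏ m, π (w m) := fun w => Finset.prod_nonneg fun m _ => hπ _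
  have htot : ∑ w : Fin n → Fin b, ∏ m, π (w m) = 1 := by rw [← Fintype.sum_pow, hπ1, one_pow]
  have hcompl : ∑ w ∈ (typicalWords π ε n)ᶜ, ∏ m, π (w m) ≤ b / (ε ^ 2 * n) := by
    calc ∑ w ∈ (typicalWords π ε n)ᶜ, ∏ m, π (w m)
        ≤ ∑ w ∈ (typicalWords π ε n)ᶜ,
          (∏ m, π (w m)) * ∑ i, ((letterCount w i : ℝ) - n * π i) ^ 2 / (ε * n) ^ 2 :=
          Finset.sum_le_sum fun w hw =>
            le_mul_of_one_le_right (hw0 w) (hc w (Finset.mem_compl.mp hw))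
      _ ≤ ∑ w, (∏ m, π (w m)) * ∑ i, ((letterCount w i : ℝ) - n * π i) ^ 2 / (ε * n) ^ 2 :=
          Finset.sum_le_sum_of_subset_of_nonneg (Finset.subset_univ _) fun w _ _ =>
            mul_nonneg (hw0 w) (Finset.sum_nonneg fun i _ => by positivity)
      _ = ∑ i, (∑ w : Fin n → Fin b, (∏ m, π (w m)) * (letterCount w i - n * π i) ^ 2) /
            (ε * n) ^ 2 := by
          simp_rw [Finset.mul_sum, Finset.sum_div]
          rw [Finset.sum_comm]
          simp_rw [mul_div_assoc]
      _ ≤ ∑ i : Fin b, (n : ℝ) / (ε * n) ^ 2 :=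
          Finset.sum_le_sum fun i _ => div_le_div_of_nonneg_right (hmom i) (by positivity)
      _ = b / (ε ^ 2 * n) := by
          rw [Finset.sum_const, Finset.card_univ, Fintype.card_fin, nsmul_eq_mul]
          field_simp
  have := Finset.sum_add_sum_compl (typicalWords π ε n) (fun w => ∏ m, π (w m))
  linarith

/-- Lower bound for the number of words with digit frequencies close to `π`. -/
theorem eventually_le_card_typicalWords {b : ℕ} {π : Fin b → ℝ} (hπ : ∀ i, 0 ≤ π i)
    (hπ1 : ∑ i, π i = 1) {h ε : ℝ} (hh : h < ∑ i, Real.negMulLog (π i)) (hε : 0 < ε) :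
    ∀ᶠ n : ℕ in atTop, Real.exp (n * h) ≤ (typicalWords π ε n).card := by
  set H : ℝ := ∑ i, Real.negMulLog (π i) with hH
  set K : ℝ := ∑ i, |Real.log (π i)| with hK
  have hK0 : 0 ≤ K := Finset.sum_nonneg fun i _ => abs_nonneg _
  set η : ℝ := min ε ((H - h) / 2 / (K + 1)) with hη
  have hη0 : 0 < η := lt_min hε (div_pos (by linarith) (by linarith))
  have hηK : η * K ≤ (H - h) / 2 := by
    have h1 : η * (K + 1) ≤ (H - h) / 2 := by
      rw [← le_div_iff₀ (by linarith)]
      exact min_le_right _ _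
    nlinarith
  have hb : Tendsto (fun n : ℕ => (b : ℝ) / (η ^ 2 * n)) atTop (𝓝 0) :=
    tendsto_const_nhds.div_atTop (tendsto_natCast_atTop_atTop.const_mul_atTop (by positivity))
  have he : Tendsto (fun n : ℕ => Real.exp (n * ((H - h) / 2))) atTop atTop :=
    Real.tendsto_exp_atTop.comp (tendsto_natCast_atTop_atTop.atTop_mul_const (by linarith))
  filter_upwards [hb.eventually (gt_mem_nhds (show (0 : ℝ) < 1 / 2 by norm_num)),
    he.eventually_ge_atTop 2, eventually_gt_atTop 0] with n hn1 hn2 hn3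
  have hsub : typicalWords π η n ⊆ typicalWords π ε n := by
    intro w hw
    rw [mem_typicalWords] at hw ⊢
    exact fun i => (hw i).trans
      (mul_le_mul_of_nonneg_right (min_le_left _ _) (Nat.cast_nonneg n))
  -- The reverse comparison: typical words carry at least half of the mass of the product measure
  -- with weights π, and each has mass at most exp(-n(H + h)/2). The spare factor exp(n(H - h)/2)
  -- absorbs the one half.
  have hw : ∀ w ∈ typicalWords π η n, ∏ m, π (w m) ≤ Real.exp (-(n * ((H + h) / 2))) := by
    intro w hw
    -- The value `Real.log 0 = 0` makes the logarithmic estimate useless here, but such a word has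
    -- mass zero.
    by_cases h0 : ∃ m, π (w m) = 0
    · obtain ⟨m, hm⟩ := h0
      rw [Finset.prod_eq_zero (Finset.mem_univ m) hm]
      positivity
    · push Not at h0
      have hpos : ∀ m, 0 < π (w m) := fun m => (hπ _).lt_of_ne (h0 m).symm
      rw [← Real.exp_log (Finset.prod_pos fun m _ => hpos m),
        Real.log_prod (fun m _ => (hpos m).ne')]
      refine Real.exp_le_exp.mpr ?_
      have h1 := (abs_le.mp (abs_sum_apply_sub_le hw (fun i => Real.log (π i)))).2
      have h2 : ∑ i, π i * Real.log (π i) = -H := by simp [hH, Real.negMulLog]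
      rw [h2, ← hK] at h1
      have h3 := mul_le_mul_of_nonneg_left hηK (Nat.cast_nonneg (α := ℝ) n)
      linarith
  have h1 := sum_prod_compl_typicalWords_le hπ hπ1 hη0 hn3
  have h2 : ∑ w ∈ typicalWords π η n, ∏ m, π (w m) ≤
      (typicalWords π η n).card * Real.exp (-(n * ((H + h) / 2))) := by
    rw [← nsmul_eq_mul, ← Finset.sum_const]
    exact Finset.sum_le_sum hw
  have h3 : (1 : ℝ) / 2 ≤ (typicalWords π η n).card * Real.exp (-(n * ((H + h) / 2))) := by
    linarith
  rw [Real.exp_neg, ← div_eq_mul_inv, le_div_iff₀ (Real.exp_pos _)] at h3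
  have h4 : Real.exp (n * ((H + h) / 2)) = Real.exp (n * h) * Real.exp (n * ((H - h) / 2)) := by
    rw [← Real.exp_add]
    congr 1
    ring
  have h5 : ((typicalWords π η n).card : ℝ) ≤ (typicalWords π ε n).card :=
    Nat.cast_le.mpr (Finset.card_le_card hsub)
  have h6 := Real.exp_pos (n * h)
  rw [h4] at h3
  nlinarith

/-- The values of the words of length `n` with digit frequencies close to `π`. -/
noncomputable def typicalValues {b : ℕ} [NeZero b] (π : Fin b → ℝ) (ε : ℝ) (n : ℕ) : Finset ℕ :=
  (typicalWords π ε n).image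
    (fun w => prefixValue (fun m => if h : m < n then w ⟨m, h⟩ else 0) n)

theorem letterCount_eq_digitCount {b n : ℕ} (a : ℕ → Fin b) (i : Fin b) :
    letterCount (fun m : Fin n => a m) i = digitCount a i n := by
  unfold letterCount digitCount
  rw [Finset.card_filter, Finset.card_filter, Finset.sum_range]

theorem mem_typicalValues {b : ℕ} [NeZero b] {π : Fin b → ℝ} {ε : ℝ} {n : ℕ} {a : ℕ → Fin b} :
    prefixValue a n ∈ typicalValues π ε n ↔ ∀ i, |(digitCount a i n : ℝ) - n * π i| ≤ ε * n := by
  rw [typicalValues, Finset.mem_image]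
  constructor
  · rintro ⟨w, hw, hwa⟩ i
    have h1 : w = fun m : Fin n => a m := by
      funext m
      have := digits_eq_of_prefixValue_eq hwa m m.isLt
      simpa using this
    rw [mem_typicalWords] at hw
    have := hw i
    rwa [h1, letterCount_eq_digitCount] at this
  · intro h
    refine ⟨fun m : Fin n => a m, mem_typicalWords.mpr fun i => ?_, ?_⟩
    · rw [letterCount_eq_digitCount]
      exact h i
    · exact prefixValue_congr fun m hm => by simp [hm]

theorem typicalValues_lt {b : ℕ} [NeZero b] {π : Fin b → ℝ} {ε : ℝ} {n k : ℕ}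
    (h : k ∈ typicalValues π ε n) : k < b ^ n := by
  obtain ⟨w, -, rfl⟩ := Finset.mem_image.mp h
  exact prefixValue_lt _ _

theorem card_typicalValues {b : ℕ} [NeZero b] (π : Fin b → ℝ) (ε : ℝ) (n : ℕ) :
    (typicalValues π ε n).card = (typicalWords π ε n).card := by
  refine Finset.card_image_of_injective _ fun w w' h => ?_
  funext m
  have := digits_eq_of_prefixValue_eq h m m.isLt
  simpa using this

/-! ### Separation of fractions. -/

theorem one_div_mul_le_abs_sub {p p' : ℤ} {q q' : ℕ} (hq : 0 < q) (hq' : 0 < q')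
    (h : (p : ℝ) / q ≠ p' / q') : 1 / ((q : ℝ) * q') ≤ |(p : ℝ) / q - p' / q'| := by
  have hq1 : (0 : ℝ) < q := Nat.cast_pos.mpr hq
  have hq2 : (0 : ℝ) < q' := Nat.cast_pos.mpr hq'
  rw [div_sub_div _ _ hq1.ne' hq2.ne', abs_div, abs_of_pos (mul_pos hq1 hq2)]
  refine div_le_div_of_nonneg_right ?_ (mul_pos hq1 hq2).le
  have h1 : (p * q' - q * p' : ℤ) ≠ 0 := by
    intro h0
    apply h
    rw [div_eq_div_iff hq1.ne' hq2.ne']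
    have : ((p * q' - q * p' : ℤ) : ℝ) = 0 := by rw [h0, Int.cast_zero]
    push_cast at this
    linarith
  have h2 := Int.one_le_abs h1
  have h3 : ((1 : ℤ) : ℝ) ≤ ((|p * q' - q * p'| : ℤ) : ℝ) := Int.cast_le.mpr h2
  push_cast at h3
  exact h3

/-- Distinct fractions with denominators below `T ^ (1 / 2)` are more than `1 / T` apart. -/
theorem one_div_lt_abs_sub {p p' : ℤ} {q q' : ℕ} (hq : 0 < q) (hq' : 0 < q') {T : ℝ}
    (hT : (q : ℝ) ^ 2 < T) (hT' : (q' : ℝ) ^ 2 < T)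
    (h : (p : ℝ) / q ≠ p' / q') : 1 / T < |(p : ℝ) / q - p' / q'| := by
  have hq1 : (0 : ℝ) < q := Nat.cast_pos.mpr hq
  have hq2 : (0 : ℝ) < q' := Nat.cast_pos.mpr hq'
  refine lt_of_lt_of_le ?_ (one_div_mul_le_abs_sub hq hq' h)
  refine one_div_lt_one_div_of_lt (mul_pos hq1 hq2) ?_
  nlinarith [sq_nonneg ((q : ℝ) - q')]

/-! ### Upper bound: covering by balls around fractions. -/

/-- The points that are `b ^ (-n * δ)`-close to a fraction with squared denominator in
`[b ^ n, b ^ (n + 1))` lying in the `b`-adic interval of rank `n + 1` and index `c`. -/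
def nearFraction (b : ℕ) (δ : ℝ) (n c : ℕ) : Set ℝ :=
  {x | ∃ p q : ℕ, 0 < q ∧ q ^ 2 < b ^ (n + 1) ∧ |x - (p : ℝ) / q| ≤ 1 / ((b : ℝ) ^ n) ^ δ ∧
    ⌊(p : ℝ) / q * (b : ℝ) ^ (n + 1)⌋₊ = c}

/-- All points of the set are close to one and the same fraction: two different candidates would be
more than b^(-(n+1)) apart, yet they lie in a common half-open interval of that length. -/
theorem ediam_nearFraction_le {b : ℕ} (hb : 0 < b) (δ : ℝ) (n c : ℕ) :
    Metric.ediam (nearFraction b δ n c) ≤ ENNReal.ofReal (2 * (1 / ((b : ℝ) ^ n) ^ δ)) := by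
  refine Metric.ediam_le ?_
  rintro x ⟨p, q, hq, hqb, hx, hc⟩ x' ⟨p', q', hq', hqb', hx', hc'⟩
  have hbp : (0 : ℝ) < (b : ℝ) ^ (n + 1) := pow_pos (Nat.cast_pos.mpr hb) _
  have heq : ((p : ℤ) : ℝ) / q = ((p' : ℤ) : ℝ) / q' := by
    by_contra hne
    have h1 := one_div_lt_abs_sub hq hq' (T := (b : ℝ) ^ (n + 1)) (by exact_mod_cast hqb)
      (by exact_mod_cast hqb') hne
    rw [div_lt_iff₀ hbp] at h1
    nth_rewrite 1 [← abs_of_pos hbp] at h1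
    rw [← abs_mul, sub_mul] at h1
    simp only [Int.cast_natCast] at h1
    have h2 := Nat.floor_le (show 0 ≤ (p : ℝ) / q * (b : ℝ) ^ (n + 1) by positivity)
    have h3 := Nat.lt_floor_add_one ((p : ℝ) / q * (b : ℝ) ^ (n + 1))
    have h4 := Nat.floor_le (show 0 ≤ (p' : ℝ) / q' * (b : ℝ) ^ (n + 1) by positivity)
    have h5 := Nat.lt_floor_add_one ((p' : ℝ) / q' * (b : ℝ) ^ (n + 1))
    rw [hc] at h2 h3
    rw [hc'] at h4 h5
    refine absurd h1 (not_lt.mpr (abs_le.mpr ⟨?_, ?_⟩)) <;> linarith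
  simp only [Int.cast_natCast] at heq
  rw [edist_dist, Real.dist_eq]
  refine ENNReal.ofReal_le_ofReal ?_
  rw [← heq] at hx'
  calc |x - x'| = |(x - (p : ℝ) / q) - (x' - (p : ℝ) / q)| := by congr 1; ring
    _ ≤ |x - (p : ℝ) / q| + |x' - (p : ℝ) / q| := abs_sub _ _
    _ ≤ _ := by linarith

theorem pow_floor_logb_sq_le {b q : ℕ} (hq : 0 < q) :
    b ^ ⌊Real.logb b ((q : ℝ) ^ 2)⌋₊ ≤ q ^ 2 := by
  rw [← Nat.cast_pow, Real.natFloor_logb_natCast]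
  exact Nat.pow_log_le_self b (by positivity)

theorem lt_pow_floor_logb_sq {b q : ℕ} (hb : 2 ≤ b) :
    q ^ 2 < b ^ (⌊Real.logb b ((q : ℝ) ^ 2)⌋₊ + 1) := by
  rw [← Nat.cast_pow, Real.natFloor_logb_natCast]
  exact Nat.lt_pow_succ_log_self hb _

theorem tendsto_floor_logb_sq {b : ℕ} (hb : 2 ≤ b) :
    Tendsto (fun q : ℕ => ⌊Real.logb b ((q : ℝ) ^ 2)⌋₊) atTop atTop := by
  have hb' : (1 : ℝ) < b := by exact_mod_cast hb
  refine tendsto_nat_floor_atTop.comp ((Real.tendsto_logb_atTop hb').comp ?_)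
  exact (tendsto_pow_atTop two_ne_zero).comp tendsto_natCast_atTop_atTop

/-- A single late term of the approximating sequence puts x into one of the pieces. An arbitrary
choice of expansion only places b^n y in the closed interval [κ, κ + 1], so the integer part of
b^(n+1) y can also be κb + b; hence b + 1 values of the last index and not b. -/
theorem approxSet_subset_iUnion_nearFraction {b : ℕ} [NeZero b] (hb : 2 ≤ b)
    {d : ℝ → ℕ → Fin b} (hd : IsExpansionChoice b d) {π : Fin b → ℝ} {δ : ℝ} (hδ : 0 ≤ δ)
    {ε : ℝ} (hε : 0 < ε) (N : ℕ) :
    approxSet b d π δ ⊆ ⋃ i : Σ n : ℕ, typicalValues π ε (n + N) × Fin (b + 1),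
      nearFraction b δ (i.1 + N) (i.2.1 * b + i.2.2) := by
  rintro x ⟨-, p, q, hpq, hq, hx, hfreq⟩
  have h1 : ∀ᶠ k in atTop, ∀ i,
      |digitFreq (d ((p k : ℝ) / (q k : ℝ))) i ⌊Real.logb b ((q k : ℝ) ^ 2)⌋₊ - π i| < ε := by
    rw [eventually_all]
    intro i
    have := (hfreq i).eventually (Metric.ball_mem_nhds _ hε)
    simpa [Real.dist_eq] using this
  -- `N + 1` instead of `N`, so that the rank n is also positive and can be divided by.
  have h2 := ((tendsto_floor_logb_sq hb).comp hq).eventually_ge_atTop (N + 1)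
  obtain ⟨k, hk1, hk2⟩ := (h1.and h2).exists
  simp only [Function.comp_apply] at hk2
  obtain ⟨hp0, hq0, hpq0⟩ := hpq k
  have hlow := pow_floor_logb_sq_le (b := b) hq0
  have hup := lt_pow_floor_logb_sq (q := q k) hb
  set n : ℕ := ⌊Real.logb b ((q k : ℝ) ^ 2)⌋₊ with hn
  have hn0 : (0 : ℝ) < n := by exact_mod_cast (by omega : 0 < n)
  have hqr : (0 : ℝ) < q k := Nat.cast_pos.mpr hq0
  set y : ℝ := (p k : ℝ) / (q k : ℝ) with hy
  have hyI : y ∈ Set.Icc (0 : ℝ) 1 :=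
    ⟨by positivity, by rw [hy, div_le_one hqr]; exact_mod_cast hpq0⟩
  have hyd := hd y hyI
  have htyp : prefixValue (d y) n ∈ typicalValues π ε n := by
    rw [mem_typicalValues]
    intro i
    have h3 := (hk1 i).le
    rw [digitFreq_eq] at h3
    have h4 : (digitCount (d y) i n : ℝ) - n * π i = (digitCount (d y) i n / (n : ℝ) - π i) * n := by
      field_simp
    rw [h4, abs_mul, abs_of_pos hn0]
    exact mul_le_mul_of_nonneg_right h3 hn0.le
  set κ : ℕ := prefixValue (d y) n with hκ
  have hb0 : (0 : ℝ) < b := by exact_mod_cast (by omega : 0 < b)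
  have hbn : (0 : ℝ) < (b : ℝ) ^ n := pow_pos hb0 n
  have hy1 : (κ : ℝ) ≤ y * (b : ℝ) ^ n := by
    rw [← div_le_iff₀ hbn, ← hyd]
    exact prefixValue_div_le (d y) n
  have hy2 : y * (b : ℝ) ^ n ≤ κ + 1 := by
    rw [← le_div_iff₀ hbn, ← hyd]
    exact le_prefixValue_add_one_div (d y) n
  have hf1 : κ * b ≤ ⌊y * (b : ℝ) ^ (n + 1)⌋₊ := by
    refine Nat.le_floor ?_
    push_cast
    rw [pow_succ, ← mul_assoc]
    exact mul_le_mul_of_nonneg_right hy1 hb0.le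
  have hf2 : ⌊y * (b : ℝ) ^ (n + 1)⌋₊ ≤ κ * b + b := by
    refine Nat.floor_le_of_le ?_
    push_cast
    rw [pow_succ, ← mul_assoc]
    nlinarith
  obtain ⟨n', hn'⟩ : ∃ n', n = n' + N := ⟨n - N, by omega⟩
  rw [Set.mem_iUnion]
  refine ⟨⟨n', ⟨⟨κ, hn' ▸ htyp⟩, ⟨⌊y * (b : ℝ) ^ (n + 1)⌋₊ - κ * b, by omega⟩⟩⟩,
    p k, q k, hq0, hn' ▸ hup, ?_, ?_⟩
  · refine (hx k).trans (one_div_le_one_div_of_le (Real.rpow_pos_of_pos (pow_pos hb0 _) _) ?_)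
    rw [Real.rpow_mul hqr.le, Real.rpow_two, ← hn']
    exact Real.rpow_le_rpow hbn.le (by exact_mod_cast hlow) hδ
  · change ⌊y * (b : ℝ) ^ (n' + N + 1)⌋₊ = κ * b + (⌊y * (b : ℝ) ^ (n + 1)⌋₊ - κ * b)
    rw [← hn']
    omega

/-- At rank n there are at most (b + 1) exp(nh') pieces of diameter at most 2 b^(-nδ), with H < h' <
s δ log b. The s-sums are dominated by a geometric series of ratio exp(h' - s δ log b) < 1, whose
tails tend to zero. -/
theorem hausdorffMeasure_approxSet_eq_zero {b : ℕ} (hb : 2 ≤ b)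
    {d : ℝ → ℕ → Fin b} (hd : IsExpansionChoice b d) {π : Fin b → ℝ} (hπ : ∀ i, 0 ≤ π i)
    (hπ1 : ∑ i, π i = 1) {δ : ℝ} (hδ : 0 < δ) {s : ℝ} (hs : 0 < s)
    (h : ∑ i, Real.negMulLog (π i) < s * (δ * Real.log b)) :
    MeasureTheory.Measure.hausdorffMeasure s (approxSet b d π δ) = 0 := by
  have : NeZero b := ⟨by omega⟩
  have hb0 : (0 : ℝ) < b := by exact_mod_cast (by omega : 0 < b)
  have hlog : 0 < Real.log b := Real.log_pos (by exact_mod_cast hb)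
  obtain ⟨h', hh1, hh2⟩ := exists_between h
  obtain ⟨ε, hε, hcard⟩ := exists_card_typicalWords_le hπ hπ1 hh1
  set D : ℕ → ℝ := fun n => 2 * (1 / ((b : ℝ) ^ n) ^ δ) with hD
  have hDexp : ∀ n : ℕ, D n = 2 * Real.exp (-(n * (δ * Real.log b))) := by
    intro n
    simp only [hD]
    rw [Real.rpow_def_of_pos (pow_pos hb0 n), Real.log_pow, one_div, ← Real.exp_neg]
    ring_nf
  have hDlim : Tendsto D atTop (𝓝 0) := by
    have h1 : Tendsto (fun n : ℕ => (n : ℝ) * (δ * Real.log b)) atTop atTop :=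
      tendsto_natCast_atTop_atTop.atTop_mul_const (by positivity)
    have h2 := (Real.tendsto_exp_neg_atTop_nhds_zero.comp h1).const_mul 2
    rw [mul_zero] at h2
    exact h2.congr fun n => (hDexp n).symm
  have hDanti : Antitone D := by
    intro m n hmn
    rw [hDexp, hDexp]
    have : (m : ℝ) * (δ * Real.log b) ≤ n * (δ * Real.log b) :=
      mul_le_mul_of_nonneg_right (Nat.cast_le.mpr hmn) (by positivity)
    have := Real.exp_le_exp.mpr (neg_le_neg this)
    linarith
  set r : ℝ := Real.exp (h' - s * (δ * Real.log b)) with hr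
  have hr1 : r < 1 := by rw [hr, Real.exp_lt_one_iff]; linarith
  set ρ : ENNReal := ENNReal.ofReal r with hρ
  have hρ1 : ρ < 1 := by rw [hρ, ENNReal.ofReal_lt_one]; exact hr1
  set c : ENNReal := ENNReal.ofReal ((b + 1) * 2 ^ s) with hc
  have hterm : ∀ n : ℕ, ((typicalValues π ε n).card * (b + 1) : ℕ) *
      ENNReal.ofReal (D n) ^ s ≤ c * ρ ^ n := by
    intro n
    have hD0 : 0 < D n := by rw [hDexp]; positivity
    rw [hρ, hc, ← ENNReal.ofReal_pow (Real.exp_pos _).le, ← ENNReal.ofReal_mul (by positivity),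
      ENNReal.ofReal_rpow_of_pos hD0, ← ENNReal.ofReal_natCast,
      ← ENNReal.ofReal_mul (Nat.cast_nonneg _)]
    refine ENNReal.ofReal_le_ofReal ?_
    rw [hDexp, Real.mul_rpow zero_le_two (Real.exp_pos _).le, ← Real.exp_mul, ← Real.exp_nat_mul,
      card_typicalValues]
    have h1 : Real.exp (n * (h' - s * (δ * Real.log b))) =
        Real.exp (n * h') * Real.exp (-(n * (δ * Real.log b)) * s) := by
      rw [← Real.exp_add]
      ring_nf
    rw [h1]
    push_cast
    have h2 := hcard n
    have h3 : 0 ≤ ((b : ℝ) + 1) * 2 ^ s * Real.exp (-(n * (δ * Real.log b)) * s) := by positivity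
    have := mul_le_mul_of_nonneg_left h2 h3
    linarith
  have hcov := MeasureTheory.Measure.hausdorffMeasure_le_liminf_tsum (β := ℕ)
    (ι := fun N => Σ n : ℕ, typicalValues π ε (n + N) × Fin (b + 1)) s (approxSet b d π δ)
    (l := atTop) (fun N => ENNReal.ofReal (D N))
    (by simpa using ENNReal.tendsto_ofReal hDlim)
    (fun N i => nearFraction b δ (i.1 + N) (i.2.1 * b + i.2.2))
    (Eventually.of_forall fun N i => (ediam_nearFraction_le (by omega) δ _ _).trans
      (ENNReal.ofReal_le_ofReal (hDanti (Nat.le_add_left N i.1))))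
    (Eventually.of_forall fun N => approxSet_subset_iUnion_nearFraction hb hd hδ.le hε N)
  have hsum : ∀ N : ℕ, ∑' i : (Σ n : ℕ, typicalValues π ε (n + N) × Fin (b + 1)),
      Metric.ediam (nearFraction b δ (i.1 + N) (i.2.1 * b + i.2.2)) ^ s ≤
        c * (1 - ρ)⁻¹ * ρ ^ N := by
    intro N
    rw [ENNReal.tsum_sigma']
    calc ∑' n : ℕ, ∑' i : typicalValues π ε (n + N) × Fin (b + 1),
          Metric.ediam (nearFraction b δ (n + N) (i.1 * b + i.2)) ^ s
        ≤ ∑' n : ℕ, c * ρ ^ N * ρ ^ n := by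
          refine ENNReal.tsum_le_tsum fun n => ?_
          rw [tsum_fintype]
          calc ∑ i : typicalValues π ε (n + N) × Fin (b + 1),
                Metric.ediam (nearFraction b δ (n + N) (i.1 * b + i.2)) ^ s
              ≤ ∑ i : typicalValues π ε (n + N) × Fin (b + 1), ENNReal.ofReal (D (n + N)) ^ s :=
                Finset.sum_le_sum fun i _ =>
                  ENNReal.rpow_le_rpow (ediam_nearFraction_le (by omega) δ _ _) hs.le
            _ = ((typicalValues π ε (n + N)).card * (b + 1) : ℕ) * ENNReal.ofReal (D (n + N)) ^ s := by
                rw [Finset.sum_const, nsmul_eq_mul, Finset.card_univ, Fintype.card_prod,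
                  Fintype.card_coe, Fintype.card_fin]
            _ ≤ c * ρ ^ (n + N) := hterm (n + N)
            _ = c * ρ ^ N * ρ ^ n := by rw [pow_add]; ring
      _ = c * (1 - ρ)⁻¹ * ρ ^ N := by
          rw [ENNReal.tsum_mul_left, ENNReal.tsum_geometric]
          ring
  have hlim : Tendsto (fun N : ℕ => c * (1 - ρ)⁻¹ * ρ ^ N) atTop (𝓝 0) := by
    have h1 := ENNReal.Tendsto.const_mul (a := c * (1 - ρ)⁻¹)
      (ENNReal.tendsto_pow_atTop_nhds_zero_of_lt_one hρ1)
      (Or.inr (ENNReal.mul_ne_top ENNReal.ofReal_ne_top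
        (ENNReal.inv_ne_top.mpr (tsub_pos_of_lt hρ1).ne')))
    rwa [mul_zero] at h1
  refine le_antisymm (hcov.trans ?_) zero_le
  rw [← hlim.liminf_eq]
  exact liminf_le_liminf (Eventually.of_forall hsum)

theorem dimH_approxSet_le {b : ℕ} (hb : 2 ≤ b)
    {d : ℝ → ℕ → Fin b} (hd : IsExpansionChoice b d) {π : Fin b → ℝ} (hπ : ∀ i, 0 ≤ π i)
    (hπ1 : ∑ i, π i = 1) {δ : ℝ} (hδ : 0 < δ) :
    dimH (approxSet b d π δ) ≤
      ENNReal.ofReal ((∑ i, Real.negMulLog (π i)) / (δ * Real.log b)) := by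
  have hlog : 0 < Real.log b := Real.log_pos (by exact_mod_cast hb)
  refine le_of_forall_gt_imp_ge_of_dense fun t ht => ?_
  obtain ⟨s, hs1, hs2⟩ := ENNReal.lt_iff_exists_nnreal_btwn.mp ht
  refine le_trans (dimH_le_of_hausdorffMeasure_ne_top ?_) hs2.le
  have hs0 : (0 : ℝ) < s := by
    have := zero_le.trans_lt hs1
    exact_mod_cast this
  rw [hausdorffMeasure_approxSet_eq_zero hb hd hπ hπ1 hδ hs0]
  · exact ENNReal.zero_ne_top
  · rw [← ENNReal.ofReal_coe_nnreal, ENNReal.ofReal_lt_ofReal_iff hs0] at hs1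
    rwa [div_lt_iff₀ (by positivity)] at hs1

/-! ### Mass distribution on trees of b-adic intervals. -/

/-- The mass distribution principle for the image of a random variable. -/
theorem ofReal_le_dimH_range {Ω X : Type*} [MeasurableSpace Ω] {P : MeasureTheory.Measure Ω}
    [MeasureTheory.IsProbabilityMeasure P] [MetricSpace X] [MeasurableSpace X] [BorelSpace X]
    {f : Ω → X} (hf : Measurable f) {s C : ℝ} (hs : 0 < s) (hC : 0 < C)
    (h : ∀ x r, 0 < r → r ≤ 1 → P (f ⁻¹' Metric.closedBall x r) ≤ ENNReal.ofReal (C * r ^ s)) :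
    ENNReal.ofReal s ≤ dimH (Set.range f) := by
  set ν : MeasureTheory.Measure X := P.map f with hν
  have hball : ∀ x r, 0 < r → r ≤ 1 → ν (Metric.closedBall x r) ≤ ENNReal.ofReal (C * r ^ s) := by
    intro x r hr hr1
    rw [hν, MeasureTheory.Measure.map_apply hf Metric.isClosed_closedBall.measurableSet]
    exact h x r hr hr1
  have hc0 : ENNReal.ofReal C ≠ 0 := (ENNReal.ofReal_pos.mpr hC).ne'
  have hdiam : ∀ U : Set X, Metric.ediam U ≤ ENNReal.ofReal (1 / 2) →
      ((ENNReal.ofReal C)⁻¹ • ν) U ≤ Metric.ediam U ^ s := by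
    intro U hU
    rcases U.eq_empty_or_nonempty with rfl | ⟨x, hx⟩
    · simp
    have hfin : Metric.ediam U ≠ ⊤ := (hU.trans_lt ENNReal.ofReal_lt_top).ne
    set r₀ : ℝ := Metric.diam U with hr₀
    have hr₀0 : 0 ≤ r₀ := Metric.diam_nonneg
    have hr₀e : Metric.ediam U = ENNReal.ofReal r₀ := (ENNReal.ofReal_toReal hfin).symm
    have hr₀1 : r₀ ≤ 1 / 2 := by
      rw [hr₀e] at hU
      exact (ENNReal.ofReal_le_ofReal_iff (by norm_num)).mp hU
    -- Balls of radius slightly larger than the diameter are used, then the radius decreases to it;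
    -- this covers sets of diameter 0. The bound 1/2 leaves room for radii below 1.
    have h1 : ∀ᶠ r in 𝓝[>] r₀, ν U ≤ ENNReal.ofReal (C * r ^ s) := by
      filter_upwards [Ioo_mem_nhdsGT (show r₀ < 1 by linarith)] with r hr
      refine le_trans (MeasureTheory.measure_mono fun y hy => ?_)
        (hball x r (hr₀0.trans_lt hr.1) hr.2.le)
      exact (Metric.dist_le_diam_of_mem (Metric.isBounded_iff_ediam_ne_top.mpr hfin) hy hx).trans
        hr.1.le
    have h2 : Tendsto (fun r : ℝ => ENNReal.ofReal (C * r ^ s)) (𝓝[>] r₀)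
        (𝓝 (ENNReal.ofReal (C * r₀ ^ s))) :=
      tendsto_nhdsWithin_of_tendsto_nhds (ENNReal.tendsto_ofReal
        (((Real.continuousAt_rpow_const _ _ (Or.inr hs.le)).tendsto).const_mul C))
    have h3 := ge_of_tendsto h2 h1
    rw [MeasureTheory.Measure.smul_apply, smul_eq_mul, hr₀e,
      ENNReal.ofReal_rpow_of_nonneg hr₀0 hs.le, mul_comm, ← div_eq_mul_inv,
      ENNReal.div_le_iff_le_mul (Or.inl hc0) (Or.inl ENNReal.ofReal_ne_top),
      ← ENNReal.ofReal_mul (by positivity), mul_comm (r₀ ^ s)]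
    exact h3
  have hle := MeasureTheory.Measure.le_hausdorffMeasure s ((ENNReal.ofReal C)⁻¹ • ν)
    (ENNReal.ofReal (1 / 2)) (ENNReal.ofReal_pos.mpr (by norm_num)) hdiam
  have h1 : 1 ≤ ν (Set.range f) := by
    have := MeasureTheory.Measure.le_map_apply (μ := P) hf.aemeasurable (Set.range f)
    rwa [Set.preimage_range, MeasureTheory.measure_univ] at this
  have h2 : MeasureTheory.Measure.hausdorffMeasure s (Set.range f) ≠ 0 := by
    have h3 := hle (Set.range f)
    rw [MeasureTheory.Measure.smul_apply, smul_eq_mul] at h3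
    have h4 : (ENNReal.ofReal C)⁻¹ * ν (Set.range f) ≠ 0 :=
      mul_ne_zero (ENNReal.inv_ne_zero.mpr ENNReal.ofReal_ne_top) (one_pos.trans_le h1).ne'
    exact ((pos_iff_ne_zero.mpr h4).trans_le h3).ne'
  have h3 := le_dimH_of_hausdorffMeasure_ne_zero (d := s.toNNReal) (s := Set.range f)
    (by rwa [Real.coe_toNNReal s hs.le])
  exact h3

/-- The node reached after `t` steps by following the branch `ω`. -/
def treeNode (child : ℕ → ℕ → ℕ → ℕ) (ω : ℕ → ℕ) : ℕ → ℕ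
  | 0 => 0
  | t + 1 => child t (treeNode child ω t) (ω t)

/-- Division by a power of b recovers the parent node, and then injectivity recovers the last
choice. -/
theorem eq_of_treeNode_eq {b : ℕ} {n M : ℕ → ℕ} {child : ℕ → ℕ → ℕ → ℕ}
    (hdiv : ∀ t k e, e < M t → child t k e / b ^ (n (t + 1) - n t) = k)
    (hinj : ∀ t k, Set.InjOn (child t k) (Set.Iio (M t))) {ω ω' : ℕ → ℕ}
    (hω : ∀ t, ω t < M t) (hω' : ∀ t, ω' t < M t) {t : ℕ}
    (h : treeNode child ω t = treeNode child ω' t) : ∀ u < t, ω u = ω' u := by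
  induction t with
  | zero => simp
  | succ t ih =>
    rw [treeNode, treeNode] at h
    have h1 : treeNode child ω t = treeNode child ω' t := by
      exact (hdiv t _ _ (hω t)).symm.trans (h ▸ hdiv t _ _ (hω' t))
    rw [h1] at h
    have h2 := hinj t _ (hω t) (hω' t) h
    intro u hu
    rcases Nat.lt_succ_iff_lt_or_eq.mp hu with h3 | rfl
    · exact ih h1 u h3
    · exact h2

theorem div_pow_le_div_pow_of_div_eq {b : ℕ} (hb : 0 < b) {n l k k' : ℕ} (hnl : n ≤ l)
    (h : k' / b ^ (l - n) = k) :
    (k : ℝ) / (b : ℝ) ^ n ≤ k' / (b : ℝ) ^ l ∧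
      ((k' : ℝ) + 1) / (b : ℝ) ^ l ≤ (k + 1) / (b : ℝ) ^ n := by
  obtain ⟨m, rfl⟩ := Nat.exists_eq_add_of_le hnl
  rw [Nat.add_sub_cancel_left] at h
  have hb0 : (0 : ℝ) < b := Nat.cast_pos.mpr hb
  have h1 : k * b ^ m ≤ k' := h ▸ Nat.div_mul_le_self _ _
  have h2 : k' + 1 ≤ (k + 1) * b ^ m := by
    have := Nat.lt_mul_div_succ k' (show 0 < b ^ m by positivity)
    rw [h] at this
    linarith
  have h3 : (k : ℝ) * (b : ℝ) ^ m ≤ k' := by exact_mod_cast h1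
  have h4 : (k' : ℝ) + 1 ≤ (k + 1) * (b : ℝ) ^ m := by exact_mod_cast h2
  have hn : 0 < (b : ℝ) ^ n := by positivity
  have hm : 0 < (b : ℝ) ^ m := by positivity
  rw [pow_add]
  constructor
  · rw [div_le_div_iff₀ hn (by positivity)]
    nlinarith
  · rw [div_le_div_iff₀ (by positivity) hn]
    nlinarith

/-- The set of points coded by the branches of a tree of nested `b`-adic intervals. -/
def treeSet (b : ℕ) (n M : ℕ → ℕ) (child : ℕ → ℕ → ℕ → ℕ) : Set ℝ :=
  {x | ∃ ω : ℕ → ℕ, (∀ t, ω t < M t) ∧ ∀ t, x ∈ Set.Icc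
    ((treeNode child ω t : ℝ) / (b : ℝ) ^ n t) ((treeNode child ω t + 1) / (b : ℝ) ^ n t)}

/-- A tree of nested `b`-adic intervals of ranks `n t` with exactly `M t` children at step `t` has
dimension at least `s` if the number of nodes after `t` steps is at least `b ^ (s * n (t + 1))` up
to a constant. -/
theorem ofReal_le_dimH_treeSet {b : ℕ} (hb : 2 ≤ b) {n M : ℕ → ℕ} (hn0 : n 0 = 0)
    (hn : StrictMono n) (hM : ∀ t, 0 < M t) {child : ℕ → ℕ → ℕ → ℕ}
    (hdiv : ∀ t k e, e < M t → child t k e / b ^ (n (t + 1) - n t) = k)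
    (hinj : ∀ t k, Set.InjOn (child t k) (Set.Iio (M t))) {s C : ℝ} (hs : 0 < s) (hC : 0 < C)
    (hcard : ∀ t, ((b : ℝ) ^ n (t + 1)) ^ s ≤ C * ∏ u ∈ Finset.range t, (M u : ℝ)) :
    ENNReal.ofReal s ≤ dimH (treeSet b n M child) := by
  have hb0 : (0 : ℝ) < b := by exact_mod_cast (by omega : 0 < b)
  have hb1 : (1 : ℝ) < b := by exact_mod_cast hb
  have hne : ∀ t, NeZero (M t) := fun t => ⟨(hM t).ne'⟩
  set P : MeasureTheory.Measure (∀ t, Fin (M t)) := MeasureTheory.Measure.infinitePi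
    (fun t => (PMF.uniformOfFintype (Fin (M t))).toMeasure) with hP
  set node : (∀ t, Fin (M t)) → ℕ → ℕ := fun ω => treeNode child (fun t => ω t) with hnode
  set u : (∀ t, Fin (M t)) → ℕ → ℝ := fun ω t => (node ω t : ℝ) / (b : ℝ) ^ n t with hu
  set v : (∀ t, Fin (M t)) → ℕ → ℝ := fun ω t => ((node ω t : ℝ) + 1) / (b : ℝ) ^ n t with hv
  have hstep : ∀ ω t, u ω t ≤ u ω (t + 1) ∧ v ω (t + 1) ≤ v ω t := fun ω t =>
    div_pow_le_div_pow_of_div_eq (by omega) (hn t.lt_succ_self).le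
      (hdiv t (node ω t) (ω t) (ω t).isLt)
  have huv : ∀ ω t, u ω t ≤ v ω t := fun ω t =>
    div_le_div_of_nonneg_right (by linarith) (by positivity)
  have hmem : ∀ ω t, (⨆ t, u ω t) ∈ Set.Icc (u ω t) (v ω t) := fun ω => Set.mem_iInter.mp
    ((monotone_nat_of_le_succ fun t => (hstep ω t).1).ciSup_mem_iInter_Icc_of_antitone
      (antitone_nat_of_succ_le fun t => (hstep ω t).2) (huv ω))
  have hsub : Set.range (fun ω => ⨆ t, u ω t) ⊆ treeSet b n M child := by
    rintro _ ⟨ω, rfl⟩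
    exact ⟨fun t => ω t, fun t => (ω t).isLt, hmem ω⟩
  have hmeas_node : ∀ t, Measurable fun ω => node ω t := by
    intro t
    induction t with
    | zero => exact measurable_const
    | succ t ih =>
      have h1 : Measurable fun p : ℕ × Fin (M t) => child t p.1 p.2 := measurable_of_countable _
      exact h1.comp (ih.prodMk (measurable_pi_apply t))
  have hmeas : Measurable fun ω => ⨆ t, u ω t := by
    refine Measurable.iSup fun t => ?_
    exact (measurable_of_countable (fun k : ℕ => (k : ℝ) / (b : ℝ) ^ n t)).comp (hmeas_node t)
  have hprob : ∀ t (c : ℕ), P {ω | node ω t = c} ≤ (∏ u ∈ Finset.range t, (M u : ENNReal))⁻¹ := by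
    intro t c
    rcases Set.eq_empty_or_nonempty {ω | node ω t = c} with h0 | ⟨ω₀, hω₀⟩
    · rw [h0, MeasureTheory.measure_empty]
      exact zero_le
    -- A node determines all choices leading to it, so the event lies in a cylinder of mass 1 / ∏ M.
    have h1 : {ω | node ω t = c} ⊆ Set.pi (Finset.range t : Set ℕ) fun u => {ω₀ u} := by
      intro ω hω u hu
      have h2 : node ω t = node ω₀ t := Eq.trans hω (Eq.symm hω₀)
      exact Fin.ext (eq_of_treeNode_eq hdiv hinj (fun t => (ω t).isLt) (fun t => (ω₀ t).isLt) h2 u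
        (by simpa using hu))
    refine (MeasureTheory.measure_mono h1).trans ?_
    rw [hP, MeasureTheory.Measure.infinitePi_pi _ (fun i _ => MeasurableSet.singleton _),
      ENNReal.prod_inv_distrib (by
        intro i _ j _ _
        exact Or.inr (ENNReal.natCast_ne_top _))]
    refine le_of_eq (Finset.prod_congr rfl fun i _ => ?_)
    rw [PMF.toMeasure_apply_singleton _ _ (MeasurableSet.singleton _),
      PMF.uniformOfFintype_apply, Fintype.card_fin]
  refine le_trans (ofReal_le_dimH_range hmeas (P := P) (C := 4 * C) hs (by positivity) ?_)
    (dimH_mono hsub)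
  intro x r hr hr1
  have hex : ∃ t, 1 / (b : ℝ) ^ n t < r := by
    obtain ⟨m, hm⟩ := pow_unbounded_of_one_lt (1 / r) hb1
    refine ⟨m, ?_⟩
    rw [div_lt_iff₀ (by positivity), ← div_lt_iff₀' hr]
    exact hm.trans_le (pow_le_pow_right₀ hb1.le hn.le_apply)
  classical
  -- At this scale a ball of radius r meets at most 4 node intervals of rank n t, whereas r exceeds
  -- b^(-n (t + 1)). This is why `hcard` compares the nodes after t steps with the rank one step
  -- later.
  obtain ⟨t, ht1, ht2⟩ : ∃ t, 1 / (b : ℝ) ^ n (t + 1) < r ∧ r ≤ 1 / (b : ℝ) ^ n t := by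
    have h1 := Nat.find_spec hex
    have h2 : Nat.find hex ≠ 0 := by
      intro h0
      rw [h0, hn0] at h1
      simp at h1
      linarith
    obtain ⟨t, ht⟩ := Nat.exists_eq_succ_of_ne_zero h2
    rw [ht] at h1
    refine ⟨t, h1, ?_⟩
    exact not_lt.mp (Nat.find_min hex (ht ▸ Nat.lt_succ_self t))
  have hbt : (0 : ℝ) < (b : ℝ) ^ n t := by positivity
  set y : ℝ := x * (b : ℝ) ^ n t with hy
  set I : Finset ℤ := Finset.Icc (⌈y⌉ - 2) (⌊y⌋ + 1) with hI
  have hIcard : I.card ≤ 4 := by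
    rw [hI, Int.card_Icc]
    have := Int.floor_le_ceil y
    omega
  have hcov : (fun ω => ⨆ t, u ω t) ⁻¹' Metric.closedBall x r ⊆
      ⋃ c ∈ I, {ω | node ω t = c.toNat} := by
    intro ω hω
    rw [Set.mem_preimage, Metric.mem_closedBall, Real.dist_eq, abs_le] at hω
    obtain ⟨h1, h2⟩ := hmem ω t
    have h3 : u ω t * (b : ℝ) ^ n t = node ω t := div_mul_cancel₀ _ hbt.ne'
    have h4 : v ω t * (b : ℝ) ^ n t = node ω t + 1 := div_mul_cancel₀ _ hbt.ne'
    have h5 : r * (b : ℝ) ^ n t ≤ 1 := by rwa [← le_div_iff₀ hbt]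
    have h6 := mul_le_mul_of_nonneg_right (show u ω t ≤ x + r by linarith [hω.2]) hbt.le
    have h7 := mul_le_mul_of_nonneg_right (show x - r ≤ v ω t by linarith [hω.1]) hbt.le
    rw [h3, add_mul, ← hy] at h6
    rw [h4, sub_mul, ← hy] at h7
    rw [Set.mem_iUnion₂]
    refine ⟨node ω t, ?_, by simp⟩
    rw [hI, Finset.mem_Icc]
    constructor
    · rw [sub_le_iff_le_add, Int.ceil_le]
      push_cast
      linarith
    · rw [← sub_le_iff_le_add, Int.le_floor]
      push_cast
      linarith
  have hMpos : 0 < ∏ u ∈ Finset.range t, (M u : ℝ) :=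
    Finset.prod_pos fun u _ => Nat.cast_pos.mpr (hM u)
  have hMe : (∏ u ∈ Finset.range t, (M u : ENNReal))⁻¹ =
      ENNReal.ofReal (∏ u ∈ Finset.range t, (M u : ℝ))⁻¹ := by
    rw [ENNReal.ofReal_inv_of_pos hMpos, ENNReal.ofReal_prod_of_nonneg fun u _ => Nat.cast_nonneg _]
    simp
  calc P ((fun ω => ⨆ t, u ω t) ⁻¹' Metric.closedBall x r)
      ≤ ∑ c ∈ I, P {ω | node ω t = c.toNat} :=
        (MeasureTheory.measure_mono hcov).trans (MeasureTheory.measure_biUnion_finset_le _ _)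
    _ ≤ ∑ c ∈ I, ENNReal.ofReal (∏ u ∈ Finset.range t, (M u : ℝ))⁻¹ :=
        Finset.sum_le_sum fun c _ => hMe ▸ hprob t c.toNat
    _ ≤ 4 * ENNReal.ofReal (∏ u ∈ Finset.range t, (M u : ℝ))⁻¹ := by
        rw [Finset.sum_const, nsmul_eq_mul]
        gcongr
        exact_mod_cast hIcard
    _ = ENNReal.ofReal (4 * (∏ u ∈ Finset.range t, (M u : ℝ))⁻¹) := by
        rw [ENNReal.ofReal_mul (by norm_num)]
        simp
    _ ≤ ENNReal.ofReal (4 * C * r ^ s) := by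
        refine ENNReal.ofReal_le_ofReal ?_
        rw [mul_assoc]
        refine mul_le_mul_of_nonneg_left ?_ (by norm_num)
        rw [inv_le_iff_one_le_mul₀ hMpos]
        have hbs : (0 : ℝ) < (b : ℝ) ^ n (t + 1) := by positivity
        have h1 : 1 ≤ ((b : ℝ) ^ n (t + 1)) ^ s * r ^ s := by
          rw [← Real.mul_rpow hbs.le hr.le]
          refine Real.one_le_rpow ?_ hs.le
          rw [div_lt_iff₀ hbs] at ht1
          linarith
        have h2 := mul_le_mul_of_nonneg_right (hcard t) (Real.rpow_nonneg hr.le s)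
        linarith

/-! ### Legal letters and fractions with large denominators. -/

/-- The letters `c` of `A` such that the `b`-adic interval of rank `n + L` and index
`k * b ^ L + c` is neither extremal in its parent of index `k` nor adjacent to a fraction with
squared denominator less than `b ^ n`. -/
noncomputable def legalLetters (b : ℕ) (A : Finset ℕ) (L n k : ℕ) : Finset ℕ :=
  @Finset.filter ℕ (fun c => c ≠ 0 ∧ c + 1 < b ^ L ∧ ∀ (p : ℤ) (q : ℕ), 0 < q → q ^ 2 < b ^ n →
    (p : ℝ) / q ∉ Set.Icc (((k : ℝ) * (b : ℝ) ^ L + c - 1) / (b : ℝ) ^ (n + L))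
      (((k : ℝ) * (b : ℝ) ^ L + c + 2) / (b : ℝ) ^ (n + L))) (Classical.decPred _) A

theorem mem_legalLetters {b : ℕ} {A : Finset ℕ} {L n k c : ℕ} :
    c ∈ legalLetters b A L n k ↔ c ∈ A ∧ c ≠ 0 ∧ c + 1 < b ^ L ∧
      ∀ (p : ℤ) (q : ℕ), 0 < q → q ^ 2 < b ^ n →
        (p : ℝ) / q ∉ Set.Icc (((k : ℝ) * (b : ℝ) ^ L + c - 1) / (b : ℝ) ^ (n + L))
          (((k : ℝ) * (b : ℝ) ^ L + c + 2) / (b : ℝ) ^ (n + L)) := by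
  exact @Finset.mem_filter ℕ _ (Classical.decPred _) A c

/-- Two letters are lost as extremal. For the others the interval enlarged by one neighbour on each
side stays in the parent, a closed interval of length b^(-n), which contains at most one fraction
with q² < b^n. That point lies in at most 4 of the enlarged closed intervals. -/
theorem card_le_card_legalLetters_add {b : ℕ} (hb : 2 ≤ b) {A : Finset ℕ} {L : ℕ}
    (hA : ∀ c ∈ A, c < b ^ L) (n k : ℕ) : A.card ≤ (legalLetters b A L n k).card + 6 := by
  classical
  have hb0 : (0 : ℝ) < b := by exact_mod_cast (by omega : 0 < b)
  have hbL : (0 : ℝ) < (b : ℝ) ^ L := by positivity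
  have hbn : (0 : ℝ) < (b : ℝ) ^ n := by positivity
  have hbnL : (0 : ℝ) < (b : ℝ) ^ (n + L) := by positivity
  obtain ⟨B, hB4, hB⟩ : ∃ B : Finset ℕ, B.card ≤ 4 ∧ ∀ c : ℕ, c ≠ 0 → c + 1 < b ^ L →
      ∀ (p : ℤ) (q : ℕ), 0 < q → q ^ 2 < b ^ n →
      (p : ℝ) / q ∈ Set.Icc (((k : ℝ) * (b : ℝ) ^ L + c - 1) / (b : ℝ) ^ (n + L))
        (((k : ℝ) * (b : ℝ) ^ L + c + 2) / (b : ℝ) ^ (n + L)) → c ∈ B := by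
    have hcyl : ∀ c : ℕ, c ≠ 0 → c + 1 < b ^ L → ∀ y : ℝ,
        y ∈ Set.Icc (((k : ℝ) * (b : ℝ) ^ L + c - 1) / (b : ℝ) ^ (n + L))
          (((k : ℝ) * (b : ℝ) ^ L + c + 2) / (b : ℝ) ^ (n + L)) →
        k / (b : ℝ) ^ n ≤ y ∧ y ≤ k / (b : ℝ) ^ n + 1 / (b : ℝ) ^ n := by
      intro c hc0 hc1 y hy
      have h1 : (1 : ℝ) ≤ c := by exact_mod_cast Nat.one_le_iff_ne_zero.mpr hc0
      have h2 : (c : ℝ) + 2 ≤ (b : ℝ) ^ L := by exact_mod_cast hc1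
      have h3 : (k : ℝ) / (b : ℝ) ^ n = k * (b : ℝ) ^ L / (b : ℝ) ^ (n + L) := by
        rw [pow_add]; field_simp
      have h4 : 1 / (b : ℝ) ^ n = (b : ℝ) ^ L / (b : ℝ) ^ (n + L) := by
        rw [pow_add]; field_simp
      rw [h3, h4, ← add_div]
      exact ⟨le_trans (div_le_div_of_nonneg_right (by linarith) hbnL.le) hy.1,
        hy.2.trans (div_le_div_of_nonneg_right (by linarith) hbnL.le)⟩
    by_cases hex : ∃ (p₀ : ℤ) (q₀ : ℕ), 0 < q₀ ∧ q₀ ^ 2 < b ^ n ∧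
        k / (b : ℝ) ^ n ≤ (p₀ : ℝ) / q₀ ∧ (p₀ : ℝ) / q₀ ≤ k / (b : ℝ) ^ n + 1 / (b : ℝ) ^ n
    · obtain ⟨p₀, q₀, hq₀, hqb₀, hl, hu⟩ := hex
      set z : ℝ := (p₀ : ℝ) / q₀ * (b : ℝ) ^ (n + L) - k * (b : ℝ) ^ L with hz
      refine ⟨(Finset.Icc (⌈z⌉ - 2) (⌊z⌋ + 1)).image Int.toNat, ?_, ?_⟩
      · refine Finset.card_image_le.trans ?_
        rw [Int.card_Icc]
        have := Int.floor_le_ceil z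
        omega
      · intro c hc0 hc1 p q hq hqb hmem
        obtain ⟨h1, h2⟩ := hcyl c hc0 hc1 _ hmem
        have heq : (p : ℝ) / q = p₀ / q₀ := by
          by_contra hne
          have h3 := one_div_lt_abs_sub hq hq₀ (T := (b : ℝ) ^ n) (by exact_mod_cast hqb)
            (by exact_mod_cast hqb₀) hne
          exact absurd h3 (not_lt.mpr (abs_le.mpr ⟨by linarith, by linarith⟩))
        rw [heq, Set.mem_Icc, div_le_iff₀ hbnL, le_div_iff₀ hbnL] at hmem
        rw [Finset.mem_image]
        refine ⟨c, ?_, by simp⟩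
        rw [Finset.mem_Icc]
        constructor
        · rw [sub_le_iff_le_add, Int.ceil_le]
          push_cast
          linarith [hmem.2]
        · rw [← sub_le_iff_le_add, Int.le_floor]
          push_cast
          linarith [hmem.1]
    · refine ⟨∅, by simp, fun c hc0 hc1 p q hq hqb hmem => (hex ?_).elim⟩
      exact ⟨p, q, hq, hqb, hcyl c hc0 hc1 _ hmem⟩
  have hsub : A ⊆ legalLetters b A L n k ∪ (({0, b ^ L - 1} : Finset ℕ) ∪ B) := by
    intro c hc
    by_cases hleg : c ∈ legalLetters b A L n k
    · exact Finset.mem_union_left _ hleg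
    refine Finset.mem_union_right _ ?_
    by_cases hc0 : c = 0
    · simp [hc0]
    by_cases hc1 : c + 1 < b ^ L
    · refine Finset.mem_union_right _ ?_
      rw [mem_legalLetters] at hleg
      push Not at hleg
      obtain ⟨p, q, hq, hqb, hmem⟩ := hleg hc hc0 hc1
      exact hB c hc0 hc1 p q hq hqb hmem
    · have := hA c hc
      have : c = b ^ L - 1 := by omega
      simp [this]
  have h1 := Finset.card_le_card hsub
  have h2 := Finset.card_union_le (legalLetters b A L n k) (({0, b ^ L - 1} : Finset ℕ) ∪ B)
  have h3 := Finset.card_union_le ({0, b ^ L - 1} : Finset ℕ) B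
  have h4 : ({0, b ^ L - 1} : Finset ℕ).card ≤ 2 := Finset.card_le_two
  omega

/-- `κ` is a sequence of nested `b`-adic intervals of ranks `n₀, n₀ + L, …, n₀ + r * L`, each
obtained from the preceding one by appending a legal letter. -/
def IsLegalPath (b : ℕ) (A : Finset ℕ) (L n₀ r : ℕ) (κ : ℕ → ℕ) : Prop :=
  ∀ i < r, ∃ c ∈ legalLetters b A L (n₀ + i * L) (κ i), κ (i + 1) = κ i * b ^ L + c

theorem IsLegalPath.div_eq {b : ℕ} {A : Finset ℕ} {L n₀ r : ℕ} {κ : ℕ → ℕ}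
    (h : IsLegalPath b A L n₀ r κ) {i : ℕ} (hi : i < r) :
    κ (i + 1) / b ^ (n₀ + (i + 1) * L - (n₀ + i * L)) = κ i := by
  obtain ⟨c, hc, hκ⟩ := h i hi
  have hc1 := (mem_legalLetters.mp hc).2.2.1
  have : n₀ + (i + 1) * L - (n₀ + i * L) = L := by
    rw [add_mul, one_mul]
    omega
  rw [this, hκ, mul_comm, Nat.mul_add_div (by omega), Nat.div_eq_of_lt (by omega), add_zero]

theorem IsLegalPath.nested {b : ℕ} (hb : 0 < b) {A : Finset ℕ} {L n₀ r : ℕ} {κ : ℕ → ℕ}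
    (h : IsLegalPath b A L n₀ r κ) {i i' : ℕ} (hii : i ≤ i') (hi : i' ≤ r) :
    (κ i : ℝ) / (b : ℝ) ^ (n₀ + i * L) ≤ κ i' / (b : ℝ) ^ (n₀ + i' * L) ∧
      ((κ i' : ℝ) + 1) / (b : ℝ) ^ (n₀ + i' * L) ≤ (κ i + 1) / (b : ℝ) ^ (n₀ + i * L) := by
  induction i', hii using Nat.le_induction with
  | base => exact ⟨le_rfl, le_rfl⟩
  | succ m hm ih =>
    obtain ⟨h1, h2⟩ := ih (by omega)
    obtain ⟨h3, h4⟩ := div_pow_le_div_pow_of_div_eq hb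
      (show n₀ + m * L ≤ n₀ + (m + 1) * L by gcongr; omega) (h.div_eq (show m < r by omega))
    exact ⟨h1.trans h3, h4.trans h2⟩

/-- Used to continue a path beyond its end, where the continuation serves only to locate a fraction.
-/
theorem IsLegalPath.exists_extension {b : ℕ} {A : Finset ℕ} {L n₀ r : ℕ} {κ : ℕ → ℕ}
    (h : IsLegalPath b A L n₀ r κ) (hne : ∀ n k, (legalLetters b A L n k).Nonempty) (r' : ℕ) :
    ∃ κ', IsLegalPath b A L n₀ r' κ' ∧ ∀ i ≤ r, κ' i = κ i := by
  choose f hf using hne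
  set κ' : ℕ → ℕ := fun i => Nat.rec (κ 0)
    (fun i v => if i < r then κ (i + 1) else v * b ^ L + f (n₀ + i * L) v) i with hκ'
  have hstep : ∀ i, κ' (i + 1) =
      if i < r then κ (i + 1) else κ' i * b ^ L + f (n₀ + i * L) (κ' i) := fun i => rfl
  have hag : ∀ i ≤ r, κ' i = κ i := by
    intro i hi
    cases i with
    | zero => rfl
    | succ i => rw [hstep, if_pos (by omega)]
  refine ⟨κ', fun i hi => ?_, hag⟩
  by_cases hir : i < r
  · rw [hag i hir.le, hag (i + 1) hir]
    exact h i hir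
  · exact ⟨f (n₀ + i * L) (κ' i), hf _ _, by rw [hstep, if_neg hir]⟩

/-- A point at the end of a long legal path is badly approximable, so that it is close to a
fraction with denominator comparable to `b ^ j`. -/
theorem IsLegalPath.exists_fraction {b : ℕ} (hb : 2 ≤ b) {A : Finset ℕ} {L n₀ R : ℕ} {κ : ℕ → ℕ}
    (h : IsLegalPath b A L n₀ (R + 5) κ) (hL : 2 ≤ L) {j : ℕ}
    (hj : 2 * j + 1 ≤ n₀ + (R + 4) * L) (hj' : n₀ + (R + 4) * L ≤ 2 * j + 2) (hnj : n₀ + L ≤ j) :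
    ∃ p q : ℕ, 0 < p ∧ 0 < q ∧ q ≤ b ^ j ∧ b ^ j < q * b ^ (2 * L) ∧
      (κ R : ℝ) / (b : ℝ) ^ (n₀ + R * L) < (p : ℝ) / q ∧
      (p : ℝ) / q < (κ R + 1) / (b : ℝ) ^ (n₀ + R * L) := by
  have hb0 : (0 : ℝ) < b := by exact_mod_cast (by omega : 0 < b)
  set x : ℝ := (κ (R + 5) : ℝ) / (b : ℝ) ^ (n₀ + (R + 5) * L) with hx
  have hxI : ∀ i ≤ R + 5, (κ i : ℝ) / (b : ℝ) ^ (n₀ + i * L) ≤ x ∧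
      x ≤ (κ i + 1) / (b : ℝ) ^ (n₀ + i * L) := by
    intro i hi
    obtain ⟨h1, h2⟩ := h.nested (by omega) hi le_rfl
    exact ⟨h1, le_trans (div_le_div_of_nonneg_right (by linarith) (by positivity)) h2⟩
  -- Dirichlet's theorem with bound b^j, applied to the left endpoint of the last interval.
  obtain ⟨p, q', hq', hqj', hpq⟩ :=
    Real.exists_int_int_abs_mul_sub_le x (n := b ^ j) (by positivity)
  obtain ⟨q, rfl⟩ := Int.eq_ofNat_of_zero_le hq'.le
  have hq : 0 < q := by exact_mod_cast hq'
  have hqj : q ≤ b ^ j := by exact_mod_cast hqj'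
  have hqr : (0 : ℝ) < q := Nat.cast_pos.mpr hq
  have hbj : (0 : ℝ) < (b : ℝ) ^ j := by positivity
  have hdist : |x - (p : ℝ) / q| < 1 / (q * (b : ℝ) ^ j) := by
    have h1 : |x - (p : ℝ) / q| = |(q : ℝ) * x - p| / q := by
      rw [← abs_of_pos hqr, ← abs_div, abs_of_pos hqr]
      congr 1
      field_simp
    rw [h1, mul_comm (q : ℝ) ((b : ℝ) ^ j), ← div_div]
    refine div_lt_div_of_pos_right ?_ hqr
    push_cast at hpq
    exact hpq.trans_lt (one_div_lt_one_div_of_lt hbj (by linarith))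
  have havoid : ∀ i < R + 5, q ^ 2 < b ^ (n₀ + i * L) →
      1 / (b : ℝ) ^ (n₀ + i * L + L) < |x - (p : ℝ) / q| := by
    intro i hi hqi
    obtain ⟨c, hc, hκ⟩ := h i hi
    have h1 := (mem_legalLetters.mp hc).2.2.2 p q hq hqi
    obtain ⟨h2, h3⟩ := hxI (i + 1) (by omega)
    rw [hκ, show n₀ + (i + 1) * L = n₀ + i * L + L by ring] at h2 h3
    push_cast at h2 h3
    by_contra hcon
    rw [not_lt, abs_le] at hcon
    apply h1
    rw [Set.mem_Icc, sub_div, show (κ i : ℝ) * (b : ℝ) ^ L + c + 2 =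
      (κ i * (b : ℝ) ^ L + c + 1) + 1 by ring, add_div _ (1 : ℝ)]
    constructor <;> linarith [hcon.1, hcon.2]
  -- Take the first i with q² < b^(n₀ + iL). Avoidance at step i and Dirichlet's bound give q b^j <
  -- b^(n₀ + (i+1)L). For i > 0 minimality bounds the right side by q² b^(2L); i = 0 is excluded by
  -- `hnj`.
  have hqlow : b ^ j < q * b ^ (2 * L) := by
    classical
    have hex : ∃ i, q ^ 2 < b ^ (n₀ + i * L) := by
      refine ⟨R + 4, ?_⟩
      calc q ^ 2 ≤ (b ^ j) ^ 2 := Nat.pow_le_pow_left hqj 2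
        _ = b ^ (2 * j) := by rw [← pow_mul, mul_comm]
        _ < b ^ (n₀ + (R + 4) * L) := Nat.pow_lt_pow_right (by omega) (by omega)
    have hle : Nat.find hex ≤ R + 4 := by
      refine Nat.find_le ?_
      calc q ^ 2 ≤ (b ^ j) ^ 2 := Nat.pow_le_pow_left hqj 2
        _ = b ^ (2 * j) := by rw [← pow_mul, mul_comm]
        _ < b ^ (n₀ + (R + 4) * L) := Nat.pow_lt_pow_right (by omega) (by omega)
    have hsp := Nat.find_spec hex
    have h1 := (havoid _ (by omega) hsp).trans hdist
    rw [one_div_lt_one_div (by positivity) (by positivity)] at h1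
    have h2 : q * b ^ j < b ^ (n₀ + Nat.find hex * L + L) := by exact_mod_cast h1
    rcases Nat.eq_zero_or_pos (Nat.find hex) with h0 | h0
    · rw [h0, zero_mul, add_zero] at h2
      have h3 : b ^ (n₀ + L) ≤ b ^ j := Nat.pow_le_pow_right (by omega) hnj
      have h4 : b ^ j ≤ q * b ^ j := Nat.le_mul_of_pos_left _ hq
      omega
    · obtain ⟨i, hi⟩ := Nat.exists_eq_succ_of_ne_zero h0.ne'
      have h3 : ¬ q ^ 2 < b ^ (n₀ + i * L) := Nat.find_min hex (by omega)
      rw [hi, show n₀ + i.succ * L + L = n₀ + i * L + 2 * L by rw [Nat.succ_eq_add_one]; ring,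
        pow_add] at h2
      have h4 : b ^ (n₀ + i * L) * b ^ (2 * L) ≤ q ^ 2 * b ^ (2 * L) :=
        Nat.mul_le_mul_right _ (not_lt.mp h3)
      have h5 : q * b ^ j < q * (q * b ^ (2 * L)) := by
        calc _ < _ := h2
          _ ≤ _ := h4
          _ = _ := by ring
      exact lt_of_mul_lt_mul_left h5 (Nat.zero_le _)
  have hclose : |x - (p : ℝ) / q| < 1 / (b : ℝ) ^ (n₀ + R * L + L) := by
    refine hdist.trans_le (one_div_le_one_div_of_le (by positivity) ?_)
    have h1 : b ^ (n₀ + R * L + L) * b ^ (2 * L) ≤ q * b ^ j * b ^ (2 * L) := by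
      calc b ^ (n₀ + R * L + L) * b ^ (2 * L) = b ^ (n₀ + R * L + L + 2 * L) :=
            (pow_add _ _ _).symm
        _ ≤ b ^ (j + j) := Nat.pow_le_pow_right (by omega) (by
            have : n₀ + (R + 4) * L = n₀ + R * L + 4 * L := by ring
            omega)
        _ = b ^ j * b ^ j := pow_add _ _ _
        _ ≤ (q * b ^ (2 * L)) * b ^ j := Nat.mul_le_mul_right _ hqlow.le
        _ = q * b ^ j * b ^ (2 * L) := by ring
    have h2 := Nat.le_of_mul_le_mul_right h1 (by positivity)
    exact_mod_cast h2
  -- The letter after `κ R` is not extremal, so a margin of one interval of rank n₀ + (R+1)L on each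
  -- side keeps p/q strictly inside the interval of `κ R`.
  obtain ⟨c, hc, hκ⟩ := h R (by omega)
  obtain ⟨-, hc0, hc1, -⟩ := mem_legalLetters.mp hc
  obtain ⟨h2, h3⟩ := hxI (R + 1) (by omega)
  rw [hκ, show n₀ + (R + 1) * L = n₀ + R * L + L by ring] at h2 h3
  push_cast at h2 h3
  rw [abs_lt] at hclose
  have hbB : (0 : ℝ) < (b : ℝ) ^ (n₀ + R * L + L) := by positivity
  have hc0' : (1 : ℝ) ≤ c := by exact_mod_cast Nat.one_le_iff_ne_zero.mpr hc0
  have hc1' : (c : ℝ) + 2 ≤ (b : ℝ) ^ L := by exact_mod_cast hc1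
  have hlow : (κ R : ℝ) / (b : ℝ) ^ (n₀ + R * L) < (p : ℝ) / q := by
    have h4 : (κ R : ℝ) / (b : ℝ) ^ (n₀ + R * L) + 1 / (b : ℝ) ^ (n₀ + R * L + L) ≤
        (κ R * (b : ℝ) ^ L + c) / (b : ℝ) ^ (n₀ + R * L + L) := by
      have : (κ R : ℝ) / (b : ℝ) ^ (n₀ + R * L) =
          κ R * (b : ℝ) ^ L / (b : ℝ) ^ (n₀ + R * L + L) := by
        rw [pow_add _ (n₀ + R * L) L]; field_simp
      rw [this, ← add_div]
      exact div_le_div_of_nonneg_right (by linarith) hbB.le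
    linarith [hclose.2]
  have hup : (p : ℝ) / q < (κ R + 1) / (b : ℝ) ^ (n₀ + R * L) := by
    have h4 : (κ R * (b : ℝ) ^ L + c + 1) / (b : ℝ) ^ (n₀ + R * L + L) +
        1 / (b : ℝ) ^ (n₀ + R * L + L) ≤ (κ R + 1) / (b : ℝ) ^ (n₀ + R * L) := by
      have : ((κ R : ℝ) + 1) / (b : ℝ) ^ (n₀ + R * L) =
          (κ R + 1) * (b : ℝ) ^ L / (b : ℝ) ^ (n₀ + R * L + L) := by
        rw [pow_add _ (n₀ + R * L) L]; field_simp
      rw [this, ← add_div]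
      exact div_le_div_of_nonneg_right (by linarith) hbB.le
    linarith [hclose.1]
  have hp : 0 < p := by
    have h5 : (0 : ℝ) < (p : ℝ) / q := lt_of_le_of_lt (by positivity) hlow
    rw [div_pos_iff_of_pos_right hqr] at h5
    exact_mod_cast h5
  obtain ⟨p', rfl⟩ := Int.eq_ofNat_of_zero_le hp.le
  exact ⟨p', q, by exact_mod_cast hp, hq, hqj, hqlow, hlow, hup⟩

/-- The digit counts along a legal path of typical letters. -/
theorem IsLegalPath.abs_digitCount_sub_le {b : ℕ} [NeZero b] {π : Fin b → ℝ} (hπ : ∀ i, 0 ≤ π i)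
    (hπ1 : ∀ i, π i ≤ 1) {ε : ℝ} {L n₀ R : ℕ} {κ : ℕ → ℕ}
    (h : IsLegalPath b (typicalValues π ε L) L n₀ R κ) {a : ℕ → Fin b}
    (ha : prefixValue a (n₀ + R * L) = κ R) (i : Fin b) :
    |(digitCount a i (n₀ + R * L) : ℝ) - (n₀ + R * L : ℕ) * π i| ≤ n₀ + R * (ε * L) := by
  induction R with
  | zero =>
    have h1 : (digitCount a i n₀ : ℝ) ≤ n₀ := Nat.cast_le.mpr (digitCount_le a i n₀)
    have h2 : (n₀ : ℝ) * π i ≤ n₀ := mul_le_of_le_one_right (Nat.cast_nonneg _) (hπ1 i)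
    have h3 : 0 ≤ (n₀ : ℝ) * π i := mul_nonneg (Nat.cast_nonneg _) (hπ i)
    have h4 : (0 : ℝ) ≤ digitCount a i n₀ := Nat.cast_nonneg _
    simp only [zero_mul, add_zero, Nat.cast_zero]
    rw [abs_le]
    constructor <;> linarith
  | succ R ih =>
    have hdiv := h.div_eq (Nat.lt_succ_self R)
    have hsplit : n₀ + (R + 1) * L = n₀ + R * L + L := by ring
    rw [hsplit] at ha hdiv ⊢
    rw [← ha, Nat.add_sub_cancel_left, prefixValue_add_div] at hdiv
    have hih := ih (fun i hi => h i (by omega)) hdiv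
    obtain ⟨c, hc, hκ⟩ := h R (by omega)
    have h1 : prefixValue (fun m => a (n₀ + R * L + m)) L = c := by
      rw [prefixValue_add, hdiv, hκ] at ha
      omega
    have h2 := (mem_legalLetters.mp hc).1
    rw [← h1, mem_typicalValues] at h2
    have h3 := h2 i
    rw [digitCount_add]
    push_cast at hih ⊢
    rw [abs_le] at hih h3 ⊢
    constructor <;> linarith [hih.1, hih.2, h3.1, h3.2]

theorem abs_digitCount_sub_le_add {b : ℕ} {a : ℕ → Fin b} {i : Fin b} {x : ℝ} (hx : 0 ≤ x)
    (hx1 : x ≤ 1) (m l : ℕ) :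
    |((digitCount a i (m + l) : ℝ) - (m + l : ℕ) * x) - (digitCount a i m - m * x)| ≤ l := by
  have h1 : (digitCount (fun t => a (m + t)) i l : ℝ) ≤ l := Nat.cast_le.mpr (digitCount_le _ i l)
  have h2 : (l : ℝ) * x ≤ l := mul_le_of_le_one_right (Nat.cast_nonneg _) hx1
  have h3 : 0 ≤ (l : ℝ) * x := mul_nonneg (Nat.cast_nonneg _) hx
  have h4 : (0 : ℝ) ≤ digitCount (fun t => a (m + t)) i l := Nat.cast_nonneg _
  rw [digitCount_add]
  push_cast
  rw [abs_le]
  constructor <;> linarith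

/-! ### From legal paths to good approximations. -/

/-- The `b`-adic interval of rank `n` and index `u` consists of points approximated by a fraction
as in the definition of `approxSet`, with precision `ε` for the digit frequencies and a
denominator at least `Q`. -/
def IsGoodNode {b : ℕ} (d : ℝ → ℕ → Fin b) (π : Fin b → ℝ) (δ ε : ℝ) (Q n u : ℕ) : Prop :=
  ∃ p q : ℕ, 0 < p ∧ 0 < q ∧ p ≤ q ∧ Q ≤ q ∧
    (∀ x ∈ Set.Icc ((u : ℝ) / (b : ℝ) ^ n) ((u + 1) / (b : ℝ) ^ n),
      |x - (p : ℝ) / q| ≤ 1 / (q : ℝ) ^ (2 * δ)) ∧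
    ∀ i, |digitFreq (d ((p : ℝ) / q)) i ⌊Real.logb b ((q : ℝ) ^ 2)⌋₊ - π i| ≤ ε

/-- Five more legal steps, available because at least 7 typical letters exist, produce a fraction
strictly inside the interval of `κ R`. Whichever expansion was chosen, its first digits are thus
those of `κ R`. The node u consists of its first n' digits, and b^(-n') ≤ b^(-2δj) ≤ q^(-2δ). -/
theorem IsLegalPath.exists_isGoodNode {b : ℕ} [NeZero b] (hb : 2 ≤ b)
    {d : ℝ → ℕ → Fin b} (hd : IsExpansionChoice b d) {π : Fin b → ℝ} (hπ : ∀ i, 0 ≤ π i)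
    (hπ1 : ∀ i, π i ≤ 1) {δ : ℝ} (hδ : 0 ≤ δ) {ε : ℝ} (hε : 0 ≤ ε) {L n₀ R Q : ℕ} {κ : ℕ → ℕ}
    (hcard : 7 ≤ (typicalValues π ε L).card)
    (h : IsLegalPath b (typicalValues π ε L) L n₀ R κ) (hκ0 : κ R < b ^ (n₀ + R * L)) (hL : 2 ≤ L)
    {j : ℕ} (hj : 2 * j + 1 ≤ n₀ + (R + 4) * L) (hj' : n₀ + (R + 4) * L ≤ 2 * j + 2)
    (hnj : n₀ + L ≤ j) (hQ : Q * b ^ (2 * L) ≤ b ^ j) (hR : (n₀ : ℝ) + 4 * L + 2 ≤ ε * (R * L))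
    (hR6 : 6 ≤ R * L) {n' : ℕ} (hn' : 2 * δ * j ≤ n') (hmn : n₀ + R * L ≤ n') :
    ∃ u, u / b ^ (n' - (n₀ + R * L)) = κ R ∧ IsGoodNode d π δ (3 * ε) Q n' u := by
  have hb0 : (0 : ℝ) < b := by exact_mod_cast (by omega : 0 < b)
  have hb1 : (1 : ℝ) ≤ b := by exact_mod_cast (by omega : 1 ≤ b)
  have hne : ∀ n k, (legalLetters b (typicalValues π ε L) L n k).Nonempty := by
    intro n k
    have := card_le_card_legalLetters_add hb (fun c hc => typicalValues_lt hc) n k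
      (A := typicalValues π ε L)
    exact Finset.card_pos.mp (by omega)
  obtain ⟨κ', hκ', hag⟩ := h.exists_extension hne (R + 5)
  obtain ⟨p, q, hp, hq, hqj, hqlow, hl, hu⟩ := hκ'.exists_fraction hb hL hj hj' hnj
  rw [hag R le_rfl] at hl hu
  set m : ℕ := n₀ + R * L with hm
  have hqr : (0 : ℝ) < q := Nat.cast_pos.mpr hq
  set y : ℝ := (p : ℝ) / q with hy
  have hy1 : y < 1 := by
    refine hu.trans_le ?_
    rw [div_le_one (by positivity)]
    exact_mod_cast hκ0
  have hyd := hd y ⟨by positivity, hy1.le⟩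
  have hpre : prefixValue (d y) m = κ R := prefixValue_eq_of_mem_Ioo (by rwa [hyd]) (by rwa [hyd])
  refine ⟨prefixValue (d y) n', ?_, p, q, hp, hq, ?_, ?_, ?_, ?_⟩
  · obtain ⟨l, rfl⟩ := Nat.exists_eq_add_of_le hmn
    rw [Nat.add_sub_cancel_left, prefixValue_add_div, hpre]
  · rw [hy, div_lt_one hqr] at hy1
    exact_mod_cast hy1.le
  · have : Q * b ^ (2 * L) < q * b ^ (2 * L) := hQ.trans_lt hqlow
    exact (lt_of_mul_lt_mul_right this (Nat.zero_le _)).le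
  · intro x hx
    have h1 := prefixValue_div_le (d y) n'
    have h2 := le_prefixValue_add_one_div (d y) n'
    rw [hyd] at h1 h2
    have h3 : |x - y| ≤ 1 / (b : ℝ) ^ n' := by
      rw [Set.mem_Icc, add_div] at hx
      rw [add_div] at h2
      rw [abs_le]
      constructor <;> linarith [hx.1, hx.2]
    refine h3.trans (one_div_le_one_div_of_le (by positivity) ?_)
    calc (q : ℝ) ^ (2 * δ) ≤ ((b : ℝ) ^ j) ^ (2 * δ) :=
          Real.rpow_le_rpow hqr.le (by exact_mod_cast hqj) (by positivity)
      _ = (b : ℝ) ^ (2 * δ * j) := by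
          rw [← Real.rpow_natCast, ← Real.rpow_mul hb0.le, mul_comm]
      _ ≤ (b : ℝ) ^ (n' : ℝ) := Real.rpow_le_rpow_of_exponent_le hb1 hn'
      _ = (b : ℝ) ^ n' := Real.rpow_natCast _ _
  · intro i
    have hlow := pow_floor_logb_sq_le (b := b) hq
    have hup := lt_pow_floor_logb_sq (q := q) hb
    set N : ℕ := ⌊Real.logb b ((q : ℝ) ^ 2)⌋₊ with hN
    have hsplit : n₀ + (R + 4) * L = m + 4 * L := by rw [hm]; ring
    have hN1 : N ≤ 2 * j := by
      refine (Nat.pow_le_pow_iff_right (show 1 < b by omega)).mp (hlow.trans ?_)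
      rw [mul_comm, pow_mul]
      exact Nat.pow_le_pow_left hqj 2
    have hN2 : 2 * j < N + 1 + 4 * L := by
      refine (Nat.pow_lt_pow_iff_right (show 1 < b by omega)).mp ?_
      calc b ^ (2 * j) = (b ^ j) ^ 2 := by rw [mul_comm, pow_mul]
        _ ≤ (q * b ^ (2 * L)) ^ 2 := Nat.pow_le_pow_left hqlow.le 2
        _ = q ^ 2 * b ^ (4 * L) := by rw [mul_pow, ← pow_mul]; ring_nf
        _ < b ^ (N + 1) * b ^ (4 * L) := Nat.mul_lt_mul_of_pos_right hup (by positivity)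
        _ = b ^ (N + 1 + 4 * L) := (pow_add _ _ _).symm
    have hcount := h.abs_digitCount_sub_le hπ hπ1 hpre i
    rw [← hm] at hcount
    -- The cut N lies in [2j - 4L, 2j] and the rank m is 2j + 1 - 4L or 2j + 2 - 4L; so N exceeds m
    -- by at most 4L, or falls short of it by at most 2.
    have hcN : |(digitCount (d y) i N : ℝ) - N * π i| ≤ n₀ + R * (ε * L) + (4 * L + 2) := by
      rcases le_total m N with hmN | hmN
      · obtain ⟨l, hl⟩ := Nat.exists_eq_add_of_le hmN
        have h1 := abs_digitCount_sub_le_add (a := d y) (i := i) (hπ i) (hπ1 i) m l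
        rw [← hl] at h1
        have h2 : (l : ℝ) ≤ 4 * L := by exact_mod_cast (by omega : l ≤ 4 * L)
        rw [abs_le] at h1 hcount ⊢
        constructor <;> linarith [h1.1, h1.2, hcount.1, hcount.2]
      · obtain ⟨l, hl⟩ := Nat.exists_eq_add_of_le hmN
        have h1 := abs_digitCount_sub_le_add (a := d y) (i := i) (hπ i) (hπ1 i) N l
        rw [← hl] at h1
        have h2 : (l : ℝ) ≤ 2 := by exact_mod_cast (by omega : l ≤ 2)
        rw [abs_le] at h1 hcount ⊢
        constructor <;> linarith [h1.1, h1.2, hcount.1, hcount.2]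
    have hNR : R * L ≤ N + 2 := by omega
    have hNR' : (R : ℝ) * L ≤ N + 2 := by exact_mod_cast hNR
    have hR6' : (6 : ℝ) ≤ R * L := by exact_mod_cast hR6
    have hN0 : (0 : ℝ) < N := by linarith
    rw [digitFreq_eq, show (digitCount (d y) i N : ℝ) / N - π i =
      (digitCount (d y) i N - N * π i) / N by field_simp, abs_div, abs_of_pos hN0,
      div_le_iff₀ hN0]
    refine hcN.trans ?_
    -- Boundary terms and block errors each contribute at most εRL; since RL ≥ 6 and RL ≤ N + 2,
    -- twice RL is at most 3N. Hence the precision 3ε.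
    have h3 : ε * (2 * (R * L)) ≤ ε * (3 * N) := mul_le_mul_of_nonneg_left (by linarith) hε
    linarith

/-! ### Lower bound: the stages of the Cantor set. -/

/-- The triple (stage, initial rank of the stage, step in the stage) at a given time: stage `k`
started at rank `l` has `R k l` free steps and one forced step, which leads to rank `nx k l`. -/
def schedule (R nx : ℕ → ℕ → ℕ) : ℕ → ℕ × ℕ × ℕ
  | 0 => (0, 0, 0)
  | t + 1 =>
    let S := schedule R nx t
    if S.2.2 < R S.1 S.2.1 then (S.1, S.2.1, S.2.2 + 1) else (S.1 + 1, nx S.1 S.2.1, 0)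

theorem schedule_step_le (R nx : ℕ → ℕ → ℕ) (t : ℕ) :
    (schedule R nx t).2.2 ≤ R (schedule R nx t).1 (schedule R nx t).2.1 := by
  induction t with
  | zero => simp [schedule]
  | succ t ih =>
    rw [schedule]
    split_ifs with h
    · exact h
    · simp

theorem schedule_add {R nx : ℕ → ℕ → ℕ} {T k l : ℕ} (h : schedule R nx T = (k, l, 0)) {i : ℕ}
    (hi : i ≤ R k l) : schedule R nx (T + i) = (k, l, i) := by
  induction i with
  | zero => exact h
  | succ i ih =>
    rw [← add_assoc, schedule, ih (by omega)]
    exact if_pos (Nat.lt_of_succ_le hi)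

theorem schedule_next {R nx : ℕ → ℕ → ℕ} {T k l : ℕ} (h : schedule R nx T = (k, l, 0)) :
    schedule R nx (T + R k l + 1) = (k + 1, nx k l, 0) := by
  rw [schedule, schedule_add h le_rfl]
  exact if_neg (lt_irrefl _)

theorem exists_schedule_eq (R nx : ℕ → ℕ → ℕ) (k : ℕ) : ∃ T l, schedule R nx T = (k, l, 0) := by
  induction k with
  | zero => exact ⟨0, 0, rfl⟩
  | succ k ih =>
    obtain ⟨T, l, h⟩ := ih
    exact ⟨_, _, schedule_next h⟩

theorem exists_injOn_of_le_card {s : Finset ℕ} {m : ℕ} (h : m ≤ s.card) :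
    ∃ f : ℕ → ℕ, Set.InjOn f (Set.Iio m) ∧ ∀ e < m, f e ∈ s := by
  refine ⟨fun e => if he : e < s.card then s.equivFin.symm ⟨e, he⟩ else 0, ?_, ?_⟩
  · intro e he e' he' hee
    have h1 : e < s.card := lt_of_lt_of_le he h
    have h2 : e' < s.card := lt_of_lt_of_le he' h
    simp only [h1, h2, dif_pos] at hee
    have := s.equivFin.symm.injective (Subtype.ext hee)
    simpa using this
  · intro e he
    have h1 : e < s.card := lt_of_lt_of_le he h
    simp only [h1, dif_pos]
    exact Subtype.property _

/-- Every branch meets a good node in each stage k, which supplies the k-th fraction. By `hMs` the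
number of nodes keeps pace with the rank during free steps; by `hRs` the free steps of one stage
alone pay for the forced jump and the first block of the next stage. -/
theorem ofReal_le_dimH_approxSet_of_schedule {b : ℕ} [NeZero b] (hb : 2 ≤ b)
    {d : ℝ → ℕ → Fin b} {π : Fin b → ℝ} {δ s : ℝ} (hs : 0 < s) {ε η : ℕ → ℝ}
    (hε : Tendsto ε atTop (𝓝 0)) {L M : ℕ → ℕ} {R nx : ℕ → ℕ → ℕ} (hL : ∀ k, 0 < L k)
    (hM : ∀ k, 0 < M k) (hMcard : ∀ k, M k + 6 ≤ (typicalValues π (η k) (L k)).card)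
    (hMs : ∀ k, ((b : ℝ) ^ L k) ^ s ≤ M k) (hnx : ∀ k l, l + R k l * L k < nx k l)
    (hRs : ∀ k l, ((b : ℝ) ^ (nx k l + L (k + 1))) ^ s ≤ (M k : ℝ) ^ R k l)
    (hgood : ∀ k l κ, IsLegalPath b (typicalValues π (η k) (L k)) (L k) l (R k l) κ →
      κ (R k l) < b ^ (l + R k l * L k) →
      ∃ u, u / b ^ (nx k l - (l + R k l * L k)) = κ (R k l) ∧
        IsGoodNode d π δ (ε k) k (nx k l) u) :
    ENNReal.ofReal s ≤ dimH (approxSet b d π δ) := by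
  classical
  have hb0 : (0 : ℝ) < b := by exact_mod_cast (by omega : 0 < b)
  have hb1 : (1 : ℝ) ≤ b := by exact_mod_cast (by omega : 1 ≤ b)
  have hfree : ∀ k n κ, ∃ f : ℕ → ℕ, Set.InjOn f (Set.Iio (M k)) ∧
      ∀ e < M k, f e ∈ legalLetters b (typicalValues π (η k) (L k)) (L k) n κ := by
    intro k n κ
    refine exists_injOn_of_le_card ?_
    have h1 := card_le_card_legalLetters_add hb (A := typicalValues π (η k) (L k))
      (fun c hc => typicalValues_lt hc) n κ
    have h2 := hMcard k
    omega
  choose f hfinj hf using hfree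
  have hforced : ∀ k l κ, ∃ u, u / b ^ (nx k l - (l + R k l * L k)) = κ ∧
      ((∃ u, u / b ^ (nx k l - (l + R k l * L k)) = κ ∧ IsGoodNode d π δ (ε k) k (nx k l) u) →
        IsGoodNode d π δ (ε k) k (nx k l) u) := by
    intro k l κ
    by_cases h : ∃ u, u / b ^ (nx k l - (l + R k l * L k)) = κ ∧
        IsGoodNode d π δ (ε k) k (nx k l) u
    · obtain ⟨u, hu1, hu2⟩ := h
      exact ⟨u, hu1, fun _ => hu2⟩
    -- A default child, which only makes the tree total: nodes reached by branches have a good child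
    -- by `hgood`.
    · exact ⟨κ * b ^ (nx k l - (l + R k l * L k)), Nat.mul_div_cancel _ (by positivity),
        fun h' => (h h').elim⟩
  choose g hgdiv hggood using hforced
  set S : ℕ → ℕ × ℕ × ℕ := schedule R nx with hS
  have hSstep : ∀ t, S (t + 1) = if (S t).2.2 < R (S t).1 (S t).2.1 then
      ((S t).1, (S t).2.1, (S t).2.2 + 1) else ((S t).1 + 1, nx (S t).1 (S t).2.1, 0) :=
    fun t => rfl
  have hSle : ∀ t, (S t).2.2 ≤ R (S t).1 (S t).2.1 := schedule_step_le R nx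
  set rank : ℕ → ℕ := fun t => (S t).2.1 + (S t).2.2 * L (S t).1 with hrank
  set N : ℕ → ℕ := fun t => if (S t).2.2 < R (S t).1 (S t).2.1 then M (S t).1 else 1 with hN
  set child : ℕ → ℕ → ℕ → ℕ := fun t κ e => if (S t).2.2 < R (S t).1 (S t).2.1 then
    κ * b ^ L (S t).1 + f (S t).1 (rank t) κ e else g (S t).1 (S t).2.1 κ with hchild
  have hrank0 : rank 0 = 0 := by simp [hrank, hS, schedule]
  have hrank_free : ∀ t, (S t).2.2 < R (S t).1 (S t).2.1 →
      rank (t + 1) = rank t + L (S t).1 := by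
    intro t ht
    simp only [hrank, hSstep t, if_pos ht]
    ring
  have hrank_forced : ∀ t, ¬ (S t).2.2 < R (S t).1 (S t).2.1 →
      rank (t + 1) = nx (S t).1 (S t).2.1 ∧
      rank t = (S t).2.1 + R (S t).1 (S t).2.1 * L (S t).1 := by
    intro t ht
    have h1 : (S t).2.2 = R (S t).1 (S t).2.1 := le_antisymm (hSle t) (not_lt.mp ht)
    constructor
    · simp only [hrank, hSstep t, if_neg ht]
      simp
    · simp only [hrank]
      rw [h1]
  have hmono : StrictMono rank := by
    refine strictMono_nat_of_lt_succ fun t => ?_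
    by_cases ht : (S t).2.2 < R (S t).1 (S t).2.1
    · rw [hrank_free t ht]
      exact Nat.lt_add_of_pos_right (hL _)
    · rw [(hrank_forced t ht).1, (hrank_forced t ht).2]
      exact hnx _ _
  have hdiv : ∀ t κ e, e < N t → child t κ e / b ^ (rank (t + 1) - rank t) = κ := by
    intro t κ e he
    by_cases ht : (S t).2.2 < R (S t).1 (S t).2.1
    · simp only [hN, if_pos ht] at he
      have h1 := (mem_legalLetters.mp (hf (S t).1 (rank t) κ e he)).2.2.1
      simp only [hchild, if_pos ht]
      rw [hrank_free t ht, Nat.add_sub_cancel_left, mul_comm, Nat.mul_add_div (by positivity),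
        Nat.div_eq_of_lt (by omega), add_zero]
    · simp only [hchild, if_neg ht]
      rw [(hrank_forced t ht).1, (hrank_forced t ht).2]
      exact hgdiv _ _ _
  have hinj : ∀ t κ, Set.InjOn (child t κ) (Set.Iio (N t)) := by
    intro t κ e he e' he' hee
    by_cases ht : (S t).2.2 < R (S t).1 (S t).2.1
    · simp only [hN, if_pos ht] at he he'
      simp only [hchild, if_pos ht] at hee
      exact hfinj (S t).1 (rank t) κ he he' (Nat.add_left_cancel hee)
    · simp only [hN, if_neg ht, Set.mem_Iio] at he he'
      omega
  have hNpos : ∀ t, 0 < N t := by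
    intro t
    simp only [hN]
    split_ifs
    · exact hM _
    · exact one_pos
  set C : ℝ := ((b : ℝ) ^ L 0) ^ s with hC
  have hC1 : 1 ≤ C := Real.one_le_rpow (one_le_pow₀ hb1) hs.le
  have hpow_add : ∀ m l : ℕ, ((b : ℝ) ^ (m + l)) ^ s = ((b : ℝ) ^ m) ^ s * ((b : ℝ) ^ l) ^ s := by
    intro m l
    rw [pow_add, Real.mul_rpow (by positivity) (by positivity)]
  -- The first bound looks one block ahead of the current rank. The second counts the free choices
  -- of the current stage, ready for `hRs` at the forced step.
  have hinv : ∀ t, ((b : ℝ) ^ (rank t + L (S t).1)) ^ s ≤ C * ∏ u ∈ Finset.range t, (N u : ℝ) ∧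
      (M (S t).1 : ℝ) ^ (S t).2.2 ≤ ∏ u ∈ Finset.range t, (N u : ℝ) := by
    intro t
    induction t with
    | zero => simp [hrank0, hC, hS, schedule]
    | succ t ih =>
      rw [Finset.prod_range_succ]
      have hP0 : 0 ≤ ∏ u ∈ Finset.range t, (N u : ℝ) :=
        Finset.prod_nonneg fun u _ => Nat.cast_nonneg _
      by_cases ht : (S t).2.2 < R (S t).1 (S t).2.1
      · have hNt : N t = M (S t).1 := by simp only [hN, if_pos ht]
        rw [hNt, hrank_free t ht, hSstep t, if_pos ht]
        constructor
        · rw [hpow_add, ← mul_assoc]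
          exact mul_le_mul ih.1 (hMs _) (by positivity) (by positivity)
        · rw [pow_succ]
          exact mul_le_mul_of_nonneg_right ih.2 (Nat.cast_nonneg _)
      · have hNt : N t = 1 := by simp only [hN, if_neg ht]
        have h1 : (S t).2.2 = R (S t).1 (S t).2.1 := le_antisymm (hSle t) (not_lt.mp ht)
        rw [hNt, (hrank_forced t ht).1, hSstep t, if_neg ht, Nat.cast_one, mul_one]
        rw [h1] at ih
        have h2 := (hRs (S t).1 (S t).2.1).trans ih.2
        constructor
        · exact h2.trans (le_mul_of_one_le_left hP0 hC1)
        · rw [pow_zero]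
          exact (Real.one_le_rpow (one_le_pow₀ hb1) hs.le).trans h2
  have hcard : ∀ t, ((b : ℝ) ^ rank (t + 1)) ^ s ≤ C * ∏ u ∈ Finset.range t, (N u : ℝ) := by
    intro t
    by_cases ht : (S t).2.2 < R (S t).1 (S t).2.1
    · rw [hrank_free t ht]
      exact (hinv t).1
    · have h1 : (S t).2.2 = R (S t).1 (S t).2.1 := le_antisymm (hSle t) (not_lt.mp ht)
      have h2 := (hinv t).2
      rw [h1] at h2
      have h3 := (hRs (S t).1 (S t).2.1).trans h2
      rw [hpow_add] at h3
      rw [(hrank_forced t ht).1]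
      have h4 : 1 ≤ ((b : ℝ) ^ L ((S t).1 + 1)) ^ s := Real.one_le_rpow (one_le_pow₀ hb1) hs.le
      have hP0 : 0 ≤ ∏ u ∈ Finset.range t, (N u : ℝ) :=
        Finset.prod_nonneg fun u _ => Nat.cast_nonneg _
      exact ((le_mul_of_one_le_right (by positivity) h4).trans h3).trans
        (le_mul_of_one_le_left hP0 hC1)
  refine (ofReal_le_dimH_treeSet hb hrank0 hmono hNpos hdiv hinj hs (by positivity) hcard).trans
    (dimH_mono ?_)
  rintro x ⟨ω, hω, hx⟩
  have hlt : ∀ t, treeNode child ω t < b ^ rank t := by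
    intro t
    induction t with
    | zero => simp [treeNode, hrank0]
    | succ t ih =>
      rw [← hdiv t (treeNode child ω t) (ω t) (hω t), Nat.div_lt_iff_lt_mul (by positivity),
        ← pow_add, Nat.add_sub_cancel' (hmono t.lt_succ_self).le] at ih
      exact ih
  have hx01 : x ∈ Set.Icc (0 : ℝ) 1 := by
    have := hx 0
    rw [hrank0] at this
    simpa [treeNode] using this
  have hstage : ∀ k, ∃ p q : ℕ, 0 < p ∧ 0 < q ∧ p ≤ q ∧ k ≤ q ∧
      |x - (p : ℝ) / q| ≤ 1 / (q : ℝ) ^ (2 * δ) ∧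
      ∀ i, |digitFreq (d ((p : ℝ) / q)) i ⌊Real.logb b ((q : ℝ) ^ 2)⌋₊ - π i| ≤ ε k := by
    intro k
    obtain ⟨T, l, hT⟩ := exists_schedule_eq R nx k
    have hTi : ∀ i ≤ R k l, S (T + i) = (k, l, i) := fun i hi => schedule_add hT hi
    have hranki : ∀ i ≤ R k l, rank (T + i) = l + i * L k := by
      intro i hi
      simp only [hrank, hTi i hi]
    have hpath : IsLegalPath b (typicalValues π (η k) (L k)) (L k) l (R k l)
        (fun i => treeNode child ω (T + i)) := by
      intro i hi
      have hSi := hTi i hi.le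
      have hωi := hω (T + i)
      simp only [hN, hSi, if_pos hi] at hωi
      refine ⟨f k (l + i * L k) (treeNode child ω (T + i)) (ω (T + i)), hf _ _ _ _ hωi, ?_⟩
      change child (T + i) (treeNode child ω (T + i)) (ω (T + i)) = _
      simp only [hchild, hSi, if_pos hi, hranki i hi.le]
    have hg := hggood k l (treeNode child ω (T + R k l))
      (hgood k l _ hpath (hranki _ le_rfl ▸ hlt (T + R k l)))
    have hnode : treeNode child ω (T + R k l + 1) = g k l (treeNode child ω (T + R k l)) := by
      change child (T + R k l) (treeNode child ω (T + R k l)) (ω (T + R k l)) = _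
      simp only [hchild, hTi _ le_rfl, lt_irrefl, if_false]
    have hrk : rank (T + R k l + 1) = nx k l := by
      simp only [hrank, hS, schedule_next hT]
      simp
    have hxT := hx (T + R k l + 1)
    rw [hnode, hrk] at hxT
    obtain ⟨p, q, hp, hq, hpq, hQ, happ, hfreq⟩ := hg
    exact ⟨p, q, hp, hq, hpq, hQ, happ x hxT, hfreq⟩
  choose p q hp hq hpq hkq happ hfreq using hstage
  refine ⟨hx01, p, q, fun k => ⟨hp k, hq k, hpq k⟩, tendsto_atTop_mono hkq tendsto_id, happ, ?_⟩
  intro i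
  rw [tendsto_iff_dist_tendsto_zero]
  exact squeeze_zero (fun k => dist_nonneg) (fun k => hfreq k i) hε

/-- A free digit gains h₁ in the logarithm of the number of nodes and, after the stretching by δ,
costs s δ log b < h₁. A sufficiently long stage therefore absorbs all costs known at its start,
including the block length of the next stage. -/
theorem ofReal_le_dimH_approxSet {b : ℕ} (hb : 2 ≤ b)
    {d : ℝ → ℕ → Fin b} (hd : IsExpansionChoice b d) {π : Fin b → ℝ} (hπ : ∀ i, 0 ≤ π i)
    (hπ1 : ∑ i, π i = 1) {δ : ℝ} (hδ : 1 ≤ δ) {s : ℝ} (hs : 0 < s)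
    (h : s * (δ * Real.log b) < ∑ i, Real.negMulLog (π i)) :
    ENNReal.ofReal s ≤ dimH (approxSet b d π δ) := by
  have : NeZero b := ⟨by omega⟩
  have hb0 : (0 : ℝ) < b := by exact_mod_cast (by omega : 0 < b)
  have hlog : 0 < Real.log b := Real.log_pos (by exact_mod_cast hb)
  have hle1 : ∀ i, π i ≤ 1 := fun i =>
    hπ1 ▸ Finset.single_le_sum (fun j _ => hπ j) (Finset.mem_univ i)
  obtain ⟨h₁, hh1, hh2⟩ := exists_between h
  obtain ⟨h₂, hh3, hh4⟩ := exists_between hh2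
  have hsδ : 0 < s * (δ * Real.log b) := by positivity
  have hrpow : ∀ m : ℕ, ((b : ℝ) ^ m) ^ s = Real.exp (m * (s * Real.log b)) := by
    intro m
    rw [Real.rpow_def_of_pos (by positivity), Real.log_pow]
    ring_nf
  set η : ℕ → ℝ := fun k => 1 / ((k : ℝ) + 1) with hη
  have hη0 : ∀ k, 0 < η k := fun k => by positivity
  have hletters : ∀ k, ∃ L M : ℕ, 2 ≤ L ∧ Real.exp (L * h₁) ≤ M ∧
      M + 6 ≤ (typicalValues π (η k) L).card := by
    intro k
    have h3 := eventually_le_card_typicalWords hπ hπ1 hh4 (hη0 k)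
    have h4 : Tendsto (fun n : ℕ => Real.exp (n * (h₂ - h₁))) atTop atTop :=
      Real.tendsto_exp_atTop.comp (tendsto_natCast_atTop_atTop.atTop_mul_const (by linarith))
    obtain ⟨L, h5, h6, h7⟩ := (h3.and ((h4.eventually_ge_atTop 8).and
      (eventually_ge_atTop 2))).exists
    -- Rounding up and the 6 lost letters add at most 7 ≤ 7 exp(L h₁), hence the factor 8 above.
    refine ⟨L, ⌈Real.exp (L * h₁)⌉₊, h7, Nat.le_ceil _, ?_⟩
    have h8 := Nat.ceil_lt_add_one (Real.exp_pos (L * h₁)).le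
    have h9 : Real.exp (L * h₂) = Real.exp (L * h₁) * Real.exp (L * (h₂ - h₁)) := by
      rw [← Real.exp_add]
      ring_nf
    have h10 : 1 ≤ Real.exp (L * h₁) := Real.one_le_exp
      (mul_nonneg (Nat.cast_nonneg _) (by linarith))
    rw [card_typicalValues]
    have h11 : ((⌈Real.exp (L * h₁)⌉₊ + 6 : ℕ) : ℝ) ≤ (typicalWords π (η k) L).card := by
      push_cast
      nlinarith
    exact_mod_cast h11
  choose L M hL hM hcard using hletters
  -- Half the rank reached 4 blocks after the free steps, rounded so that this rank is 2j + 1 or 2j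
  -- + 2.
  set j : ℕ → ℕ → ℕ → ℕ := fun k l r => (l + (r + 4) * L k - 1) / 2 with hj
  set nx : ℕ → ℕ → ℕ → ℕ := fun k l r => ⌈2 * δ * j k l r⌉₊ + 1 with hnx
  have hR : ∀ k l, ∃ r, l + L k + k + 2 * L k + 6 ≤ r ∧ (l : ℝ) + 4 * L k + 2 ≤ η k * r ∧
      ((δ * (l + 4 * L k) + 2 + L (k + 1)) * (s * Real.log b)) ≤
        (h₁ - s * (δ * Real.log b)) * r := by
    intro k l
    have h1 : Tendsto (fun r : ℕ => η k * (r : ℝ)) atTop atTop :=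
      tendsto_natCast_atTop_atTop.const_mul_atTop (hη0 k)
    have h2 : Tendsto (fun r : ℕ => (h₁ - s * (δ * Real.log b)) * (r : ℝ)) atTop atTop :=
      tendsto_natCast_atTop_atTop.const_mul_atTop (by linarith)
    exact ((eventually_ge_atTop _).and ((h1.eventually_ge_atTop _).and
      (h2.eventually_ge_atTop _))).exists
  choose R hR1 hR2 hR3 using hR
  have hLpos : ∀ k, 0 < L k := fun k => lt_of_lt_of_le two_pos (hL k)
  have hMpos : ∀ k, 0 < M k := fun k => by
    have := (Real.exp_pos _).trans_le (hM k)
    exact_mod_cast this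
  have hRL : ∀ k l, 2 * R k l ≤ R k l * L k := fun k l => by
    rw [mul_comm]
    exact Nat.mul_le_mul_left _ (hL k)
  have hjle : ∀ k l, 2 * j k l (R k l) + 1 ≤ l + (R k l + 4) * L k := fun k l => by
    have := hLpos k
    have : 0 < (R k l + 4) * L k := by positivity
    simp only [hj]
    omega
  have hlej : ∀ k l, l + (R k l + 4) * L k ≤ 2 * j k l (R k l) + 2 := fun k l => by
    simp only [hj]
    omega
  have hexp : ∀ k l, (R k l + 4) * L k = R k l * L k + 4 * L k := fun k l => by ring
  have hRj : ∀ k l, R k l ≤ j k l (R k l) := fun k l => by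
    have h1 := hlej k l
    have h2 := hRL k l
    have h3 := hL k
    rw [hexp] at h1
    omega
  have hceil : ∀ k l, 2 * j k l (R k l) ≤ ⌈2 * δ * j k l (R k l)⌉₊ := fun k l => by
    have h1 : ((2 * j k l (R k l) : ℕ) : ℝ) ≤ ⌈2 * δ * j k l (R k l)⌉₊ := by
      refine le_trans ?_ (Nat.le_ceil _)
      push_cast
      exact mul_le_mul_of_nonneg_right (by linarith) (Nat.cast_nonneg _)
    exact_mod_cast h1
  have hη_tendsto : Tendsto (fun k => 3 * η k) atTop (𝓝 0) := by
    have := (tendsto_one_div_add_atTop_nhds_zero_nat (𝕜 := ℝ)).const_mul 3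
    rwa [mul_zero] at this
  refine ofReal_le_dimH_approxSet_of_schedule hb hs hη_tendsto (R := R) (nx := fun k l => nx k l (R k l))
    hLpos hMpos hcard ?_ ?_ ?_ ?_
  · intro k
    rw [hrpow]
    refine le_trans (Real.exp_le_exp.mpr (mul_le_mul_of_nonneg_left ?_ (Nat.cast_nonneg _))) (hM k)
    nlinarith [mul_pos hs hlog]
  · intro k l
    have h1 := hceil k l
    have h3 := hlej k l
    have h4 := hL k
    rw [hexp] at h3
    simp only [hnx]
    omega
  · intro k l
    have h1 : Real.exp (R k l * (L k * h₁)) ≤ (M k : ℝ) ^ R k l := by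
      rw [Real.exp_nat_mul]
      exact pow_le_pow_left₀ (Real.exp_pos _).le (hM k) _
    refine le_trans ?_ h1
    rw [hrpow]
    refine Real.exp_le_exp.mpr ?_
    have h2 : (nx k l (R k l) : ℝ) ≤ δ * (2 * j k l (R k l)) + 2 := by
      have := Nat.ceil_lt_add_one (show 0 ≤ 2 * δ * (j k l (R k l) : ℝ) by positivity)
      simp only [hnx]
      push_cast
      linarith
    have h3 : (2 : ℝ) * j k l (R k l) ≤ l + (R k l + 4) * L k := by
      have := hjle k l
      exact_mod_cast (by omega : 2 * j k l (R k l) ≤ l + (R k l + 4) * L k)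
    have h4 : δ * (2 * (j k l (R k l) : ℝ)) ≤ δ * (l + (R k l + 4) * L k) :=
      mul_le_mul_of_nonneg_left h3 (by linarith)
    have h5 : ((nx k l (R k l) + L (k + 1) : ℕ) : ℝ) ≤
        (δ * (l + 4 * L k) + 2 + L (k + 1)) + δ * (R k l * L k) := by
      push_cast
      linarith
    have h6 := mul_le_mul_of_nonneg_right h5 (mul_pos hs hlog).le
    have h7 : (R k l : ℝ) ≤ R k l * L k :=
      le_mul_of_one_le_right (Nat.cast_nonneg _) (by exact_mod_cast hLpos k)
    have h8 : (h₁ - s * (δ * Real.log b)) * (R k l : ℝ) ≤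
        (h₁ - s * (δ * Real.log b)) * (R k l * L k) :=
      mul_le_mul_of_nonneg_left h7 (by linarith)
    have h9 := hR3 k l
    linarith
  · intro k l κ hκ hκlt
    have h1 := hR1 k l
    have h2 := hRL k l
    have h3 := hRj k l
    refine hκ.exists_isGoodNode hb hd hπ hle1 (by linarith) (hη0 k).le
      (by have := hcard k; have := hMpos k; omega) hκlt (hL k) (hjle k l) (hlej k l) (by omega)
      ?_ ?_ (by omega) ?_ ?_
    · calc k * b ^ (2 * L k) ≤ b ^ k * b ^ (2 * L k) :=
            Nat.mul_le_mul_right _ (Nat.lt_pow_self (by omega)).le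
        _ = b ^ (k + 2 * L k) := (pow_add _ _ _).symm
        _ ≤ b ^ j k l (R k l) := Nat.pow_le_pow_right (by omega) (by omega)
    · refine (hR2 k l).trans (mul_le_mul_of_nonneg_left ?_ (hη0 k).le)
      exact le_mul_of_one_le_right (Nat.cast_nonneg _) (by exact_mod_cast hLpos k)
    · simp only [hnx]
      push_cast
      linarith [Nat.le_ceil (2 * δ * (j k l (R k l) : ℝ))]
    · have h4 := hceil k l
      have h6 := hlej k l
      have h7 := hL k
      rw [hexp] at h6
      simp only [hnx]
      omega

theorem mainTheorem7 (b : ℕ) (hb : 2 ≤ b)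
    (d : ℝ → ℕ → Fin b) (hd : IsExpansionChoice b d)
    (π : Fin b → ℝ) (hπ : ∀ i, 0 ≤ π i) (hπ1 : ∑ i, π i = 1)
    (δ : ℝ) (hδ : 1 ≤ δ) :
    dimH (approxSet b d π δ) =
      ENNReal.ofReal ((∑ i, -(π i) * Real.logb b (π i)) / δ) := by
  have hlog : 0 < Real.log b := Real.log_pos (by exact_mod_cast hb)
  have hent : (∑ i, -(π i) * Real.logb b (π i)) / δ =
      (∑ i, Real.negMulLog (π i)) / (δ * Real.log b) := by
    rw [mul_comm δ, ← div_div]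
    congr 1
    rw [Finset.sum_div]
    refine Finset.sum_congr rfl fun i _ => ?_
    rw [Real.negMulLog, Real.logb, mul_div_assoc]
  rw [hent]
  refine le_antisymm (dimH_approxSet_le hb hd hπ hπ1 (by linarith)) ?_
  refine le_of_forall_lt_imp_le_of_dense fun t ht => ?_
  obtain ⟨s, hs1, hs2⟩ := ENNReal.lt_iff_exists_nnreal_btwn.mp ht
  refine hs1.le.trans ?_
  have hs0 : (0 : ℝ) < s := by
    have := zero_le.trans_lt hs1
    exact_mod_cast this
  have hs3 : (s : ℝ) < (∑ i, Real.negMulLog (π i)) / (δ * Real.log b) := by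
    rw [← ENNReal.ofReal_coe_nnreal] at hs2
    exact (ENNReal.ofReal_lt_ofReal_iff_of_nonneg hs0.le).mp hs2
  rw [lt_div_iff₀ (by positivity)] at hs3
  have := ofReal_le_dimH_approxSet hb hd hπ hπ1 hδ hs0 hs3
  rwa [ENNReal.ofReal_coe_nnreal] at this
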